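/- \textbf{Theorem} (Generalized Dye's theorem, $L^{2}$ form). Let $\mathcal{N}$ be a finite von Neumann algebra with a faithful, normal, normalized trace $\tau$, and let $A\subset\mathcal{N}$ be a masa (maximal abelian selfadjoint subalgebra). Let $L^{2}(\mathcal{N},\tau)$ be the completion of $\mathcal{N}$ in the norm $\|x\|_{2}=\tau(x^{*}x)^{1/2}$, with the left and right actions of $\mathcal{N}$ that extend left and right multiplication, and for a von Neumann subalgebra $B\subset\mathcal{N}$ let $L^{2}(B,\tau)\subset L^{2}(\mathcal{N},\tau)$ be the $\|\cdot\|_{2}$-closure of $B$. Put \[ N^{f}(A)=\{x\in\mathcal{N}: Ax=xA\},\qquad N^{f}_{2}(A)=\{\zeta\in L^{2}(\mathcal{N},\tau): A\zeta=\zeta A\} \] (equalities of sets), let $\mathcal{GN}(A)$ be the set of partial isometries $v\in\mathcal{N}$ with $v^{*}v,\,vv^{*}\in A$ and $vAv^{*}=Avv^{*}=vv^{*}A$, and let $N(A)$ be the group of unitaries $u\in\mathcal{N}$ with $uAu^{*}=A$. Then for every $\zeta\in L^{2}(\mathcal{N},\tau)$, \[ \zeta\in N^{f}_{2}(A)\iff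 \zeta=v\xi\ \text{ for some } \xi\in L^{2}(A,\tau) \text{ and } v\in\mathcal{GN}(A). \] In particular, $\overline{\operatorname{span}}^{\|\cdot\|_{2}}N^{f}(A)=L^{2}(N(A)'',\tau)$, where $N(A)''$ is the von Neumann algebra generated by $N(A)$. -/

import Mathlib

open scoped ComplexOrder InnerProductSpace

namespace VonNeumannAlgebra

section CStar

/-! ### A von Neumann algebra as a C⋆-algebra -/

variable {H : Type*} [NormedAddCommGroup H] [InnerProductSpace ℂ H] [CompleteSpace H]

instance instSMulMemClassComplex : SMulMemClass (VonNeumannAlgebra H) ℂ (H →L[ℂ] H) where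
  smul_mem {N} c _ hx := N.toStarSubalgebra.smul_mem hx c

theorem isClosed_coe (N : VonNeumannAlgebra H) : IsClosed (N : Set (H →L[ℂ] H)) := by
  rw [← N.centralizer_centralizer]
  exact Set.isClosed_centralizer _

/-- A von Neumann algebra is a C⋆-algebra for the operator norm. -/
noncomputable instance instCStarAlgebra (N : VonNeumannAlgebra H) : CStarAlgebra N :=
  StarSubalgebra.cstarAlgebra N (h_closed := N.isClosed_coe)

/-- The order on a von Neumann algebra is the operator (Loewner) order, inherited from `B(H)`; its
positive elements are the elements `s⋆ s` with `s` in the algebra. -/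
instance instStarOrderedRing (N : VonNeumannAlgebra H) : StarOrderedRing N := by
  refine StarOrderedRing.of_le_iff fun x y => ⟨fun h => ?_, ?_⟩
  · have h' : (0 : H →L[ℂ] H) ≤ (y : H →L[ℂ] H) - x := sub_nonneg.mpr h
    have hmem : CFC.sqrt ((y : H →L[ℂ] H) - x) ∈ N := by
      suffices h : CFC.sqrt ((y : H →L[ℂ] H) - x) ∈ N.commutant.commutant by
        simpa only [commutant_commutant] using h
      rw [mem_commutant_iff]
      intro g hg
      have hc : Commute ((y : H →L[ℂ] H) - x) g :=
        (mem_commutant_iff.mp hg _ (y - x).2)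
      exact (hc.cfcₙ_nnreal NNReal.sqrt).symm
    refine ⟨⟨_, hmem⟩, Subtype.ext ?_⟩
    have hs : star (CFC.sqrt ((y : H →L[ℂ] H) - x)) = CFC.sqrt ((y : H →L[ℂ] H) - x) :=
      (IsSelfAdjoint.of_nonneg (CFC.sqrt_nonneg _)).star_eq
    have := CFC.sqrt_mul_sqrt_self ((y : H →L[ℂ] H) - x) h'
    change (y : H →L[ℂ] H) = x + star (CFC.sqrt ((y : H →L[ℂ] H) - x)) * _
    rw [hs, this]
    abel
  · rintro ⟨s, rfl⟩
    change (x : H →L[ℂ] H) ≤ x + star (s : H →L[ℂ] H) * s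
    exact le_add_of_nonneg_right (star_mul_self_nonneg _)

end CStar

section Dye

variable {H : Type*} [NormedAddCommGroup H] [InnerProductSpace ℂ H] [CompleteSpace H]
variable {N : VonNeumannAlgebra H}

/-! ### Faithful normal tracial states and `L²(N, τ)` -/

/-- A positive linear functional `τ` on `N` is a faithful, normal (that is, ultraweakly continuous)
tracial state. A von Neumann algebra that has such a `τ` is finite. -/
structure IsFaithfulNormalTracialState (τ : N →ₚ[ℂ] ℂ) : Prop where
  map_one : τ 1 = 1
  tracial : ∀ x y : N, τ (x * y) = τ (y * x)
  faithful : ∀ x : N, τ (star x * x) = 0 → x = 0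
  normal : ∃ ξ η : ℕ → H, Summable (fun n => ‖ξ n‖ ^ 2) ∧ Summable (fun n => ‖η n‖ ^ 2) ∧
    ∀ x : N, HasSum (fun n => ⟪ξ n, (x : H →L[ℂ] H) (η n)⟫_ℂ) (τ x)

/-- `L²(N, τ)`: the completion of `N` in the norm `‖x‖₂ = τ(x⋆ x)^(1/2)`. -/
noncomputable abbrev L2 (τ : N →ₚ[ℂ] ℂ) : Type _ := τ.GNS

/-- The canonical map `x ↦ x̂` of `N` into `L²(N, τ)`. -/
noncomputable def hat (τ : N →ₚ[ℂ] ℂ) (x : N) : L2 τ := ((τ.toPreGNS x : τ.PreGNS) : τ.GNS)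

/-- The left action of `N` on `L²(N, τ)`: the continuous extension of left multiplication. -/
noncomputable def leftMul (τ : N →ₚ[ℂ] ℂ) (a : N) : L2 τ →L[ℂ] L2 τ := τ.gnsStarAlgHom a

theorem leftMul_hat (τ : N →ₚ[ℂ] ℂ) (a x : N) : leftMul τ a (hat τ x) = hat τ (a * x) := by
  simp [leftMul, hat]

theorem norm_preGNS_star {τ : N →ₚ[ℂ] ℂ} (hτ : IsFaithfulNormalTracialState τ) (x : N) :
    ‖τ.toPreGNS (star x)‖ = ‖τ.toPreGNS x‖ := by
  rw [PositiveLinearMap.preGNS_norm_def, PositiveLinearMap.preGNS_norm_def]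
  simp [hτ.tracial x (star x)]

/-- Right multiplication by `b` on `N`, as a `‖·‖₂`-bounded operator. -/
noncomputable def rightMulPre {τ : N →ₚ[ℂ] ℂ} (hτ : IsFaithfulNormalTracialState τ) (b : N) :
    τ.PreGNS →L[ℂ] τ.PreGNS :=
  (τ.toPreGNS.toLinearMap ∘ₗ LinearMap.mulRight ℂ b ∘ₗ τ.ofPreGNS.toLinearMap).mkContinuous ‖b‖ <| by
    intro x
    have h1 : ‖τ.toPreGNS (τ.ofPreGNS x * b)‖ = ‖τ.toPreGNS (star b * star (τ.ofPreGNS x))‖ := by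
      rw [← star_mul, norm_preGNS_star hτ]
    have h2 : ‖τ.toPreGNS (star (τ.ofPreGNS x))‖ = ‖x‖ := norm_preGNS_star hτ (τ.ofPreGNS x)
    have h3 : ‖τ.leftMulMapPreGNS (star b) (τ.toPreGNS (star (τ.ofPreGNS x)))‖ ≤
        ‖star b‖ * ‖τ.toPreGNS (star (τ.ofPreGNS x))‖ :=
      (τ.leftMulMapPreGNS (star b)).le_of_opNorm_le
        (LinearMap.mkContinuous_norm_le _ (norm_nonneg _) _) _
    rw [norm_star, h2] at h3
    exact h1.trans_le h3

/-- The right action of `N` on `L²(N, τ)`: the continuous extension of right multiplication, so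
that `rightMul hτ b ζ` is `ζ b = J b⋆ J ζ`. -/
noncomputable def rightMul {τ : N →ₚ[ℂ] ℂ} (hτ : IsFaithfulNormalTracialState τ) (b : N) :
    L2 τ →L[ℂ] L2 τ :=
  (rightMulPre hτ b).completion

theorem rightMul_hat {τ : N →ₚ[ℂ] ℂ} (hτ : IsFaithfulNormalTracialState τ) (b x : N) :
    rightMul hτ b (hat τ x) = hat τ (x * b) := by
  simp [rightMul, hat, rightMulPre]

/-- For a subset `S` of `B(H)`, the `‖·‖₂`-closed linear span of `S ∩ N` in `L²(N, τ)`. When `S` is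
a von Neumann subalgebra `B` of `N` this is `L²(B, τ)`. -/
noncomputable def L2Of (τ : N →ₚ[ℂ] ℂ) (S : Set (H →L[ℂ] H)) : Submodule ℂ (L2 τ) :=
  (Submodule.span ℂ (hat τ '' {x : N | (x : H →L[ℂ] H) ∈ S})).topologicalClosure

/-! ### Masas, normalisers and fundamental sets -/

/-- `A` is a masa in `N`: a maximal element among the abelian selfadjoint unital subalgebras
of `N`. -/
def IsMasa (N A : VonNeumannAlgebra H) : Prop :=
  Maximal (fun B : StarSubalgebra ℂ (H →L[ℂ] H) =>
    (∀ x ∈ B, x ∈ N) ∧ ∀ x ∈ B, ∀ y ∈ B, x * y = y * x) A.toStarSubalgebra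

/-- The normaliser `N(A)`: the unitaries `u` of `N` with `u A u⋆ = A`. -/
def normaliser (N A : VonNeumannAlgebra H) : Set (H →L[ℂ] H) :=
  {u | u ∈ N ∧ u ∈ unitary (H →L[ℂ] H) ∧ (fun a => u * a * star u) '' (A : Set (H →L[ℂ] H)) = A}

/-- The normalising groupoid `GN(A)`: the partial isometries `v` of `N` with `v⋆ v, v v⋆ ∈ A` and
`v A v⋆ = A v v⋆ = v v⋆ A`. -/
def normalisingGroupoid (N A : VonNeumannAlgebra H) : Set N :=
  {v | v * star v * v = v ∧
    ((star v * v : N) : H →L[ℂ] H) ∈ A ∧ ((v * star v : N) : H →L[ℂ] H) ∈ A ∧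
    (fun a : H →L[ℂ] H => v * a * star (v : H →L[ℂ] H)) '' A =
      (fun a : H →L[ℂ] H => a * (v * star (v : H →L[ℂ] H))) '' A ∧
    (fun a : H →L[ℂ] H => a * (v * star (v : H →L[ℂ] H))) '' A =
      (fun a : H →L[ℂ] H => v * star (v : H →L[ℂ] H) * a) '' A}

/-- The fundamental set `{x ∈ N : A x = x A}`. -/
def fundamentalSet (N A : VonNeumannAlgebra H) : Set (H →L[ℂ] H) :=
  {x | x ∈ N ∧ (fun a => a * x) '' (A : Set (H →L[ℂ] H)) = (fun a => x * a) '' A}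

/-- The weak fundamental set `{ζ ∈ L²(N, τ) : A ζ = ζ A}`. -/
def weakFundamentalSet {τ : N →ₚ[ℂ] ℂ} (hτ : IsFaithfulNormalTracialState τ)
    (A : VonNeumannAlgebra H) : Set (L2 τ) :=
  {ζ | (fun a : N => leftMul τ a ζ) '' {a : N | (a : H →L[ℂ] H) ∈ A} =
    (fun a : N => rightMul hτ a ζ) '' {a : N | (a : H →L[ℂ] H) ∈ A}}

end Dye

end VonNeumannAlgebra

/-!
Everything rests on one fact about `L²(N, τ)`: a vector `β` with `‖β x‖₂ ≤ ‖x‖₂` for all `x ∈ N` is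
the image of an element of `N` (`exists_hat_eq_of_leftBounded`). The unit ball of `N` is closed in
`L²(N, τ)`, because bounded weak operator limits exist and `τ` is normal, and a functional that
separated `β` from it would contradict the duality between `‖·‖₁` and the operator norm.

Unbounded operators are avoided by representing a vector `ζ` as a fraction: projecting `(1, 0)` onto
the closed graph of `x ↦ ζ x` gives `b, c ∈ N` with `ζ b = c`, where formally `b = (1 + ζ⋆ζ)⁻¹` and
`c = ζ b` (`exists_rightMul_eq_hat`). As the graph is canonical, relations `a ζ = ζ d` and
`a⋆ ζ = ζ d⋆` pass to `d b = b d` and `a c = c d`.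

Let `A ζ = ζ A`. If `a ζ = ζ d` with `a, d ∈ A`, then `a⋆ ζ = ζ d⋆`, since `L_a - R_d` is a normal
operator with `ζ` in its kernel. Hence `b` commutes with `A`, so `b ∈ A` and `c⋆c = b - b² ∈ A`; the
polar part `v` of `c` satisfies `a v = v d`, which makes it an element of `GN(A)`, and
`ζ = v (v⋆ ζ)`. The vector `v⋆ ζ` commutes with `A`, and such vectors form `L²(A, τ)`
(`mem_L2Of_iff_commute`): the part of one that is orthogonal to `L²(A, τ)` is a fraction with
`b, c ∈ A`, therefore zero.

For the second assertion all spaces are compared with the closed span `W` of `N(A)`. It equals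
`L²(N(A)'', τ)` by the bicommutant theorem on `ℓ²(H)` and normality of `τ`
(`L2Of_centralizer_centralizer_le`). That `W` contains `Nᶠ(A)` reduces to `GN(A) ⊆ W`
(`hat_mem_L2Of_normaliser`). If `p, q ∈ A` are orthogonal projections and `v ∈ GN(A)`, then
`w = q v p` is a partial isometry with orthogonal initial and final projections, and
`w + w⋆ + (1 - w⋆w - ww⋆)` is a unitary of `N(A)`; so `q v p ∈ W`. The component `η` of `v`
orthogonal to `W` therefore satisfies `q η p = 0`, so it commutes with the projections of `A`, hence
lies in `L²(A, τ) ⊆ W` and vanishes.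
-/

namespace VonNeumannAlgebra

/-! ### The two actions on `L²(N, τ)` -/

section Actions

variable {H : Type*} [NormedAddCommGroup H] [InnerProductSpace ℂ H] [CompleteSpace H]
variable {N : VonNeumannAlgebra H}

/-- The canonical map `x ↦ x̂` as a linear map. -/
noncomputable def hatₗ (τ : N →ₚ[ℂ] ℂ) : N →ₗ[ℂ] L2 τ where
  toFun := hat τ
  map_add' x y := by simp [hat, UniformSpace.Completion.coe_add]
  map_smul' c x := by simp [hat, UniformSpace.Completion.coe_smul]

variable (τ : N →ₚ[ℂ] ℂ)

theorem hat_add (x y : N) : hat τ (x + y) = hat τ x + hat τ y := (hatₗ τ).map_add x y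

theorem hat_sub (x y : N) : hat τ (x - y) = hat τ x - hat τ y := (hatₗ τ).map_sub x y

theorem hat_smul (c : ℂ) (x : N) : hat τ (c • x) = c • hat τ x := (hatₗ τ).map_smul c x

theorem hat_zero : hat τ 0 = 0 := (hatₗ τ).map_zero

theorem inner_hat (x y : N) : ⟪hat τ x, hat τ y⟫_ℂ = τ (star x * y) := by
  simp [hat, UniformSpace.Completion.inner_coe, PositiveLinearMap.preGNS_inner_def]

theorem norm_hat_sq (x : N) : ((‖hat τ x‖ ^ 2 : ℝ) : ℂ) = τ (star x * x) := by
  rw [← inner_hat, inner_self_eq_norm_sq_to_K]; norm_cast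

theorem denseRange_hat : DenseRange (hat τ) := by
  have h := UniformSpace.Completion.denseRange_coe (α := τ.PreGNS)
  exact h.comp (f := fun x : N => τ.toPreGNS x) τ.toPreGNS.surjective.denseRange
    (UniformSpace.Completion.continuous_coe _)

/-- Two vectors agree when they have the same inner products with the dense set of all `x̂`. -/
theorem ext_hat {β γ : L2 τ} (h : ∀ y, ⟪hat τ y, β⟫_ℂ = ⟪hat τ y, γ⟫_ℂ) : β = γ := by
  refine ext_inner_left ℂ fun v => ?_
  refine (denseRange_hat τ).induction_on (p := fun v => ⟪v, β⟫_ℂ = ⟪v, γ⟫_ℂ) v ?_ h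
  exact isClosed_eq (by fun_prop) (by fun_prop)

/-- Two bounded operators agree when they agree on the dense set of all `x̂`. -/
theorem clm_ext_hat {S T : L2 τ →L[ℂ] L2 τ} (h : ∀ x, S (hat τ x) = T (hat τ x)) : S = T := by
  ext v
  refine (denseRange_hat τ).induction_on (p := fun v => S v = T v) v ?_ h
  exact isClosed_eq (by fun_prop) (by fun_prop)

theorem leftMul_add (a b : N) : leftMul τ (a + b) = leftMul τ a + leftMul τ b :=
  map_add τ.gnsStarAlgHom a b

theorem leftMul_smul (c : ℂ) (a : N) : leftMul τ (c • a) = c • leftMul τ a :=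
  map_smul τ.gnsStarAlgHom c a

theorem leftMul_sub (a b : N) : leftMul τ (a - b) = leftMul τ a - leftMul τ b :=
  map_sub τ.gnsStarAlgHom a b

theorem leftMul_mul_apply (a b : N) (ζ : L2 τ) :
    leftMul τ (a * b) ζ = leftMul τ a (leftMul τ b ζ) :=
  congrArg (· ζ) (map_mul τ.gnsStarAlgHom a b)

theorem leftMul_one_apply (ζ : L2 τ) : leftMul τ 1 ζ = ζ :=
  congrArg (· ζ) (map_one τ.gnsStarAlgHom)

theorem star_leftMul (a : N) : star (leftMul τ a) = leftMul τ (star a) :=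
  (map_star τ.gnsStarAlgHom a).symm

theorem inner_leftMul (a : N) (ζ η : L2 τ) :
    ⟪ζ, leftMul τ a η⟫_ℂ = ⟪leftMul τ (star a) ζ, η⟫_ℂ := by
  rw [← star_leftMul, ContinuousLinearMap.star_eq_adjoint, ContinuousLinearMap.adjoint_inner_left]

theorem norm_leftMul_le (a : N) : ‖leftMul τ a‖ ≤ ‖a‖ :=
  NonUnitalStarAlgHom.norm_apply_le τ.gnsStarAlgHom a

theorem norm_leftMul_apply_le (a : N) (ζ : L2 τ) : ‖leftMul τ a ζ‖ ≤ ‖a‖ * ‖ζ‖ :=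
  (leftMul τ a).le_of_opNorm_le (norm_leftMul_le τ a) ζ

variable {τ} (hτ : IsFaithfulNormalTracialState τ)
include hτ

theorem norm_hat_star (x : N) : ‖hat τ (star x)‖ = ‖hat τ x‖ := by
  simpa [hat] using norm_preGNS_star hτ x

theorem norm_hat_one : ‖hat τ 1‖ = 1 := by
  have h := norm_hat_sq τ 1
  rw [star_one, one_mul, hτ.map_one] at h
  have h' : ‖hat τ 1‖ ^ 2 = 1 := by exact_mod_cast h
  nlinarith [norm_nonneg (hat τ 1)]

theorem norm_hat_le (x : N) : ‖hat τ x‖ ≤ ‖x‖ := by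
  have h := norm_leftMul_apply_le τ x (hat τ 1)
  rwa [leftMul_hat, mul_one, norm_hat_one hτ, mul_one] at h

theorem hat_injective : Function.Injective (hat τ) := by
  intro x y h
  rw [← sub_eq_zero]
  apply hτ.faithful
  rw [← inner_hat, hat_sub, h, sub_self, inner_zero_left]

theorem rightMul_add (a b : N) : rightMul hτ (a + b) = rightMul hτ a + rightMul hτ b :=
  clm_ext_hat τ fun x => by simp [rightMul_hat, mul_add, hat_add]

theorem rightMul_smul (c : ℂ) (a : N) : rightMul hτ (c • a) = c • rightMul hτ a :=
  clm_ext_hat τ fun x => by simp [rightMul_hat, hat_smul]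

theorem rightMul_sub (a b : N) : rightMul hτ (a - b) = rightMul hτ a - rightMul hτ b :=
  clm_ext_hat τ fun x => by simp [rightMul_hat, mul_sub, hat_sub]

theorem rightMul_mul_apply (a b : N) (ζ : L2 τ) :
    rightMul hτ (a * b) ζ = rightMul hτ b (rightMul hτ a ζ) :=
  congrArg (· ζ) (clm_ext_hat τ (S := rightMul hτ (a * b)) (T := rightMul hτ b ∘L rightMul hτ a)
    fun x => by simp [rightMul_hat, mul_assoc])

theorem rightMul_one_apply (ζ : L2 τ) : rightMul hτ 1 ζ = ζ :=
  congrArg (· ζ) (clm_ext_hat τ (S := rightMul hτ 1) (T := .id ℂ _)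
    fun x => by simp [rightMul_hat])

theorem leftMul_rightMul (a b : N) (ζ : L2 τ) :
    leftMul τ a (rightMul hτ b ζ) = rightMul hτ b (leftMul τ a ζ) :=
  congrArg (· ζ) (clm_ext_hat τ (S := leftMul τ a ∘L rightMul hτ b)
    (T := rightMul hτ b ∘L leftMul τ a) fun x => by simp [rightMul_hat, leftMul_hat, mul_assoc])

/-- The trace property says that right multiplication by `b⋆` is adjoint to right multiplication
by `b`. -/
theorem star_rightMul (b : N) : star (rightMul hτ b) = rightMul hτ (star b) := by
  refine clm_ext_hat τ fun x => ext_hat τ fun y => ?_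
  rw [ContinuousLinearMap.star_eq_adjoint, ContinuousLinearMap.adjoint_inner_right, rightMul_hat,
    rightMul_hat, inner_hat, inner_hat, star_mul, mul_assoc, hτ.tracial, mul_assoc]

theorem inner_rightMul (b : N) (ζ η : L2 τ) :
    ⟪ζ, rightMul hτ b η⟫_ℂ = ⟪rightMul hτ (star b) ζ, η⟫_ℂ := by
  rw [← star_rightMul, ContinuousLinearMap.star_eq_adjoint, ContinuousLinearMap.adjoint_inner_left]

theorem rightMul_hat_one (x : N) : rightMul hτ x (hat τ 1) = hat τ x := by
  rw [rightMul_hat, one_mul]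

omit hτ in
theorem leftMul_hat_one (x : N) : leftMul τ x (hat τ 1) = hat τ x := by
  rw [leftMul_hat, mul_one]

end Actions

/-! ### Left bounded vectors -/

section WeakLimit

open Filter Topology

variable {H : Type*} [NormedAddCommGroup H] [InnerProductSpace ℂ H] [CompleteSpace H]

/-- The unit ball of `B(H)` is compact in the weak operator topology. -/
theorem exists_tendsto_inner_ultrafilter (x : ℕ → H →L[ℂ] H) (hx : ∀ n, ‖x n‖ ≤ 1)
    (U : Ultrafilter ℕ) : ∃ T : H →L[ℂ] H, ‖T‖ ≤ 1 ∧
      ∀ ξ η, Tendsto (fun n => ⟪ξ, x n η⟫_ℂ) U (𝓝 ⟪ξ, T η⟫_ℂ) := by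
  have hlim : ∀ ξ η : H, ∃ l : ℂ, ‖l‖ ≤ 1 * ‖ξ‖ * ‖η‖ ∧
      Tendsto (fun n => ⟪x n ξ, η⟫_ℂ) U (𝓝 l) := by
    intro ξ η
    have hmem : ∀ n, ⟪x n ξ, η⟫_ℂ ∈ Metric.closedBall (0 : ℂ) (1 * ‖ξ‖ * ‖η‖) := by
      intro n
      rw [mem_closedBall_zero_iff]
      exact (norm_inner_le_norm _ _).trans
        (mul_le_mul_of_nonneg_right ((x n).le_of_opNorm_le (hx n) ξ) (norm_nonneg _))
    obtain ⟨l, hl, hUl⟩ := (isCompact_closedBall (0 : ℂ) (1 * ‖ξ‖ * ‖η‖)).ultrafilter_le_nhds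
      (U.map fun n => ⟪x n ξ, η⟫_ℂ) (by
        rw [le_principal_iff, Ultrafilter.mem_coe, Ultrafilter.mem_map]
        exact univ_mem' hmem)
    exact ⟨l, mem_closedBall_zero_iff.mp hl, hUl⟩
  choose l hl hlt using hlim
  let B : H →ₗ⋆[ℂ] H →ₗ[ℂ] ℂ := LinearMap.mk₂'ₛₗ (starRingEnd ℂ) (RingHom.id ℂ) l
    (fun ξ ξ' η => tendsto_nhds_unique (hlt _ _)
      (((hlt ξ η).add (hlt ξ' η)).congr fun n => by rw [map_add, inner_add_left]))
    (fun c ξ η => tendsto_nhds_unique (hlt _ _)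
      (((hlt ξ η).const_mul (starRingEnd ℂ c)).congr fun n => by rw [map_smul, inner_smul_left]))
    (fun ξ η η' => tendsto_nhds_unique (hlt _ _)
      (((hlt ξ η).add (hlt ξ η')).congr fun n => by rw [inner_add_right]))
    (fun c ξ η => tendsto_nhds_unique (hlt _ _)
      (((hlt ξ η).const_mul c).congr fun n => by rw [inner_smul_right]))
  let B' : H →L⋆[ℂ] H →L[ℂ] ℂ := B.mkContinuous₂ 1 hl
  have hT : ∀ ξ η, ⟪InnerProductSpace.continuousLinearMapOfBilin B' ξ, η⟫_ℂ = l ξ η := fun ξ η =>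
    InnerProductSpace.continuousLinearMapOfBilin_apply B' ξ η
  refine ⟨InnerProductSpace.continuousLinearMapOfBilin B', ?_, fun ξ η => ?_⟩
  · refine ContinuousLinearMap.opNorm_le_bound _ zero_le_one fun ξ => ?_
    set v := InnerProductSpace.continuousLinearMapOfBilin B' ξ with hv
    have h1 : ‖v‖ * ‖v‖ ≤ 1 * ‖ξ‖ * ‖v‖ := by
      have := hl ξ v
      rwa [← hT, ← hv, inner_self_eq_norm_sq_to_K, norm_pow, RCLike.norm_ofReal, abs_norm, sq] at this
    rcases (norm_nonneg v).eq_or_lt with h0 | h0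
    · rw [← h0]; positivity
    · exact le_of_mul_le_mul_right h1 h0
  · have h := (Complex.continuous_conj.tendsto _).comp (hlt η ξ)
    rw [← hT, inner_conj_symm] at h
    exact h.congr fun n => inner_conj_symm _ _

/-- A von Neumann algebra is closed under weak operator limits. -/
theorem mem_of_tendsto_inner (N : VonNeumannAlgebra H) {x : ℕ → H →L[ℂ] H} (hx : ∀ n, x n ∈ N)
    {U : Ultrafilter ℕ} {T : H →L[ℂ] H}
    (h : ∀ ξ η, Tendsto (fun n => ⟪ξ, x n η⟫_ℂ) U (𝓝 ⟪ξ, T η⟫_ℂ)) : T ∈ N := by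
  rw [← commutant_commutant N, mem_commutant_iff]
  intro g hg
  ext η
  refine ext_inner_left ℂ fun ξ => tendsto_nhds_unique ?_ (h ξ (g η))
  have h1 := h (ContinuousLinearMap.adjoint g ξ) η
  rw [ContinuousLinearMap.adjoint_inner_left] at h1
  refine h1.congr fun n => ?_
  rw [ContinuousLinearMap.adjoint_inner_left]
  exact congrArg (fun S : H →L[ℂ] H => ⟪ξ, S η⟫_ℂ) (mem_commutant_iff.mp hg _ (hx n)).symm

end WeakLimit

section LeftBounded

open Filter Topology

variable {H : Type*} [NormedAddCommGroup H] [InnerProductSpace ℂ H] [CompleteSpace H]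
variable {N : VonNeumannAlgebra H} {τ : N →ₚ[ℂ] ℂ} (hτ : IsFaithfulNormalTracialState τ)
include hτ

/-- A normal functional is weak operator continuous on bounded sets. -/
theorem tendsto_of_tendsto_inner {x : ℕ → N} {C : ℝ} (hx : ∀ n, ‖x n‖ ≤ C) {U : Ultrafilter ℕ}
    {T : N}
    (h : ∀ ξ η, Tendsto (fun n => ⟪ξ, (x n : H →L[ℂ] H) η⟫_ℂ) U (𝓝 ⟪ξ, (T : H →L[ℂ] H) η⟫_ℂ)) :
    Tendsto (fun n => τ (x n)) U (𝓝 (τ T)) := by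
  obtain ⟨ξ, η, hξ, hη, hs⟩ := hτ.normal
  rw [← (hs T).tsum_eq]
  simp_rw [← fun n => (hs (x n)).tsum_eq]
  refine tendsto_tsum_of_dominated_convergence (bound := fun k => C * (‖ξ k‖ ^ 2 + ‖η k‖ ^ 2))
    ((hξ.add hη).mul_left C) (fun k => h (ξ k) (η k)) (Eventually.of_forall fun n k => ?_)
  have h1 : ‖(x n : H →L[ℂ] H) (η k)‖ ≤ C * ‖η k‖ :=
    (x n : H →L[ℂ] H).le_of_opNorm_le (hx n) _
  have hC : 0 ≤ C := (norm_nonneg _).trans (hx n)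
  calc ‖⟪ξ k, (x n : H →L[ℂ] H) (η k)⟫_ℂ‖ ≤ ‖ξ k‖ * ‖(x n : H →L[ℂ] H) (η k)‖ :=
        norm_inner_le_norm _ _
    _ ≤ ‖ξ k‖ * (C * ‖η k‖) := by gcongr
    _ = C * (‖ξ k‖ * ‖η k‖) := by ring
    _ ≤ C * (‖ξ k‖ ^ 2 + ‖η k‖ ^ 2) := by
        gcongr
        nlinarith [sq_nonneg (‖ξ k‖ - ‖η k‖), sq_nonneg (‖ξ k‖), sq_nonneg (‖η k‖)]

/-- The operator unit ball of `N` is complete in the norm `‖·‖₂`. -/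
theorem isClosed_hat_closedBall : IsClosed (hat τ '' {x : N | ‖x‖ ≤ 1}) := by
  refine isClosed_of_closure_subset fun β hβ => ?_
  obtain ⟨s, hs, hsβ⟩ := mem_closure_iff_seq_limit.mp hβ
  choose x hx hxs using hs
  let U : Ultrafilter ℕ := hyperfilter ℕ
  obtain ⟨T, hT1, hT⟩ := exists_tendsto_inner_ultrafilter (fun n => (x n : H →L[ℂ] H)) hx U
  have hTN : T ∈ N := mem_of_tendsto_inner N (fun n => (x n).2) hT
  refine ⟨⟨T, hTN⟩, hT1, ?_⟩
  have hsU : Tendsto s U (𝓝 β) := hsβ.mono_left Nat.hyperfilter_le_atTop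
  refine ext_hat τ fun y => tendsto_nhds_unique ?_
    ((tendsto_const_nhds (x := hat τ y)).inner hsU)
  have hmul : ∀ n, ‖star y * x n‖ ≤ ‖star y‖ := fun n =>
    (norm_mul_le _ _).trans (mul_le_of_le_one_right (norm_nonneg _) (hx n))
  have := tendsto_of_tendsto_inner hτ hmul (U := U) (T := star y * ⟨T, hTN⟩) fun ξ η => by
    have h1 := hT ((y : H →L[ℂ] H) ξ) η
    have h2 : ∀ S : H →L[ℂ] H, ⟪ξ, (star (y : H →L[ℂ] H) * S) η⟫_ℂ =
        ⟪(y : H →L[ℂ] H) ξ, S η⟫_ℂ := fun S => by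
      rw [mul_apply_eq_comp, ContinuousLinearMap.star_eq_adjoint,
        ContinuousLinearMap.adjoint_inner_right]
    exact (h2 T).symm ▸ h1.congr fun n => (h2 _).symm
  rw [inner_hat]
  exact this.congr fun n => by rw [← hxs, inner_hat]

/-- If `‖β x‖₂ ≤ ‖x‖₂` for all `x`, then `Re τ(y⋆ β)` is at most `‖y‖₁`, up to any `δ > 0`; and
`‖y‖₁` is approximated by pairing `y` with the contraction `u = y (y⋆ y + δ²)^(-1/2)`. -/
theorem exists_re_inner_le_of_leftBounded {β : L2 τ}
    (hβ : ∀ x, ‖rightMul hτ x β‖ ≤ ‖hat τ x‖) (y : N) {δ : ℝ} (hδ : 0 < δ) :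
    ∃ u : N, ‖u‖ ≤ 1 ∧ (⟪hat τ y, β⟫_ℂ).re ≤ (⟪hat τ y, hat τ u⟫_ℂ).re + δ := by
  set z : N := star y * y with hz
  have hz0 : 0 ≤ z := star_mul_self_nonneg y
  have hzs : IsSelfAdjoint z := .of_nonneg hz0
  -- below, `h = (y⋆ y + δ²)^(1/2)`, `g = h⁻¹` and `k = h^(1/2)`; the absolute value makes `φ` positive
  -- on all of `ℝ`
  let φ : ℝ → ℝ := fun t => √(|t| + δ ^ 2)
  have hφδ : ∀ t, δ ≤ φ t := fun t => Real.le_sqrt_of_sq_le (by linarith [abs_nonneg t])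
  have hφ0 : ∀ t, 0 < φ t := fun t => hδ.trans_le (hφδ t)
  have hφsq : ∀ t, φ t * φ t = |t| + δ ^ 2 := fun t => Real.mul_self_sqrt (by positivity)
  have hφc : Continuous φ := by fun_prop
  have hφi : Continuous fun t => (φ t)⁻¹ := hφc.inv₀ fun t => (hφ0 t).ne'
  have hφt : Continuous fun t => t * (φ t)⁻¹ := continuous_id'.mul hφi
  have hφr : Continuous fun t => √(φ t) := by fun_prop
  set h : N := cfc φ z with hh
  set g : N := cfc (fun t => (φ t)⁻¹) z with hg
  set k : N := cfc (fun t => √(φ t)) z with hk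
  have hks : star k = k := (cfc_predicate (R := ℝ) _ z : IsSelfAdjoint k)
  have hgs : star g = g := (cfc_predicate (R := ℝ) _ z : IsSelfAdjoint g)
  have hkk : k * k = h := by
    rw [hk, ← cfc_mul _ _ z hφr.continuousOn hφr.continuousOn, hh]
    exact cfc_congr fun t _ => Real.mul_self_sqrt (hφ0 t).le
  have hgh : g * h = 1 := by
    rw [hg, hh, ← cfc_mul _ _ z hφi.continuousOn hφc.continuousOn, ← cfc_one ℝ z]
    exact cfc_congr fun t _ => inv_mul_cancel₀ (hφ0 t).ne'
  have hzg : z * g = cfc (fun t => t * (φ t)⁻¹) z := by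
    conv_lhs => rw [← cfc_id' ℝ z]
    rw [hg, ← cfc_mul _ _ z continuous_id'.continuousOn hφi.continuousOn]
  have hu : ‖y * g‖ ≤ 1 := by
    have h1 : star (y * g) * (y * g) = cfc (fun t => (φ t)⁻¹ * (t * (φ t)⁻¹)) z := by
      rw [star_mul, hgs, mul_assoc, ← mul_assoc (star y), ← hz, hzg, hg,
        ← cfc_mul _ _ z hφi.continuousOn hφt.continuousOn]
    have h2 : ‖star (y * g) * (y * g)‖ ≤ 1 := by
      rw [h1]
      refine norm_cfc_le zero_le_one fun t _ => ?_
      rw [mul_left_comm, ← mul_inv, hφsq, Real.norm_eq_abs, ← div_eq_mul_inv, abs_div,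
        abs_of_pos (a := |t| + δ ^ 2) (by positivity), div_le_one (by positivity)]
      linarith [sq_nonneg δ]
    rw [CStarRing.norm_star_mul_self] at h2
    nlinarith [norm_nonneg (y * g)]
  refine ⟨y * g, hu, ?_⟩
  -- `y = u k k` with `u = y g`, and one factor `k` is moved to the right of `β`
  have h1 : (⟪hat τ y, β⟫_ℂ).re ≤ (τ h).re := by
    have e1 : hat τ y = rightMul hτ k (leftMul τ (y * g) (hat τ k)) := by
      rw [leftMul_hat, rightMul_hat, mul_assoc, hkk, mul_assoc, hgh, mul_one]
    have e2 : ⟪hat τ y, β⟫_ℂ = ⟪leftMul τ (y * g) (hat τ k), rightMul hτ k β⟫_ℂ := by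
      rw [inner_rightMul, hks, e1]
    have e3 : (τ h).re = ‖hat τ k‖ ^ 2 := by
      have := norm_hat_sq τ k
      rw [hks, hkk] at this
      rw [← this, Complex.ofReal_re]
    rw [e2, e3, sq]
    refine (Complex.re_le_norm _).trans ((norm_inner_le_norm _ _).trans ?_)
    gcongr
    · exact (norm_leftMul_apply_le τ _ _).trans (mul_le_of_le_one_left (norm_nonneg _) hu)
    · exact hβ k
  have h2 : (τ h).re - (τ (z * g)).re ≤ δ := by
    have e1 : ‖h - z * g‖ ≤ δ := by
      rw [hzg, hh, ← cfc_sub _ _ z hφc.continuousOn hφt.continuousOn]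
      refine norm_cfc_le hδ.le fun t ht => ?_
      have ht0 : 0 ≤ t := spectrum_nonneg_of_nonneg hz0 ht
      have : φ t - t * (φ t)⁻¹ = δ ^ 2 * (φ t)⁻¹ := by
        have := hφsq t
        rw [abs_of_nonneg ht0] at this
        field_simp [(hφ0 t).ne']
        linarith
      rw [this, Real.norm_of_nonneg (mul_nonneg (sq_nonneg _) (inv_nonneg.mpr (hφ0 t).le)),
        ← div_eq_mul_inv, div_le_iff₀ (hφ0 t), sq]
      exact mul_le_mul_of_nonneg_left (hφδ t) hδ.le
    have e2 : τ (h - z * g) = ⟪hat τ 1, hat τ (h - z * g)⟫_ℂ := by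
      rw [inner_hat, star_one, one_mul]
    rw [← Complex.sub_re, ← map_sub, e2]
    refine (Complex.re_le_norm _).trans ((norm_inner_le_norm _ _).trans ?_)
    rw [norm_hat_one hτ, one_mul]
    exact (norm_hat_le hτ _).trans e1
  rw [inner_hat, ← mul_assoc, ← hz]
  linarith

/-- A vector `β` that acts on the left as a contraction, `‖β x‖₂ ≤ ‖x‖₂`, comes from an element
of `N`. Hahn–Banach: no functional separates `β` from the unit ball of `N`. -/
theorem exists_hat_eq_of_leftBounded {β : L2 τ}
    (hβ : ∀ x, ‖rightMul hτ x β‖ ≤ ‖hat τ x‖) : ∃ b : N, hat τ b = β := by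
  have hβ1 : ‖β‖ ≤ 1 := by
    have := hβ 1
    rwa [rightMul_one_apply, norm_hat_one hτ] at this
  suffices hmem : β ∈ hat τ '' {x : N | ‖x‖ ≤ 1} by
    obtain ⟨b, -, hb⟩ := hmem
    exact ⟨b, hb⟩
  by_contra hmem
  have hconv : Convex ℝ (hat τ '' {x : N | ‖x‖ ≤ 1}) := by
    have h1 : Convex ℝ {x : N | ‖x‖ ≤ 1} := by
      have := convex_closedBall (0 : N) 1
      simpa [Metric.closedBall, dist_zero_right] using this
    exact h1.linear_image ((hatₗ τ).restrictScalars ℝ)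
  obtain ⟨f, c, hfc, hcf⟩ := RCLike.geometric_hahn_banach_closed_point (𝕜 := ℂ) hconv
    (isClosed_hat_closedBall hτ) hmem
  obtain ⟨η, rfl⟩ := (InnerProductSpace.toDual ℂ (L2 τ)).surjective f
  simp only [InnerProductSpace.toDual_apply_apply, RCLike.re_to_complex] at hfc hcf
  set κ := (⟪η, β⟫_ℂ).re - c with hκ
  have hκ0 : 0 < κ / 4 := by linarith
  obtain ⟨y, hy⟩ := (denseRange_hat τ).exists_dist_lt η hκ0
  rw [dist_eq_norm] at hy
  obtain ⟨u, hu1, hu⟩ := exists_re_inner_le_of_leftBounded hτ hβ y hκ0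
  have key : ∀ v : L2 τ, ‖v‖ ≤ 1 → |(⟪η, v⟫_ℂ).re - (⟪hat τ y, v⟫_ℂ).re| ≤ κ / 4 := by
    intro v hv
    rw [← Complex.sub_re, ← inner_sub_left]
    refine (Complex.abs_re_le_norm _).trans ((norm_inner_le_norm _ _).trans ?_)
    exact (mul_le_of_le_one_right (norm_nonneg _) hv).trans hy.le
  have k1 := abs_le.mp (key β hβ1)
  have k2 := abs_le.mp (key (hat τ u) ((norm_hat_le hτ u).trans hu1))
  have k3 := hfc _ ⟨u, hu1, rfl⟩
  linarith [k1.1, k1.2, k2.1, k2.2]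

end LeftBounded

/-! ### The graph of a vector of `L²(N, τ)` -/

section Graph

open Filter Topology

variable {H : Type*} [NormedAddCommGroup H] [InnerProductSpace ℂ H] [CompleteSpace H]
variable {N : VonNeumannAlgebra H} {τ : N →ₚ[ℂ] ℂ} (hτ : IsFaithfulNormalTracialState τ)

/-- The closure of the graph of the densely defined operator `x̂ ↦ ζ x`. -/
def graph (ζ : L2 τ) : Set (L2 τ × L2 τ) :=
  closure (Set.range fun x : N => (hat τ x, rightMul hτ x ζ))

/-- `(β, γ)` is the orthogonal projection of `(ξ, 0)` onto the graph of `ζ`. Writing `T` for the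
closure of `x̂ ↦ ζ x`, this says `β = (1 + T⋆T)⁻¹ ξ` and `γ = T β`. -/
structure IsGraphProj (ζ ξ β γ : L2 τ) : Prop where
  mem : (β, γ) ∈ graph hτ ζ
  orth : ∀ y, ⟪hat τ y, ξ - β⟫_ℂ = ⟪rightMul hτ y ζ, γ⟫_ℂ

variable {hτ}

theorem exists_isGraphProj (ζ ξ : L2 τ) : ∃ β γ, IsGraphProj hτ ζ ξ β γ := by
  let g : N →ₗ[ℂ] WithLp 2 (L2 τ × L2 τ) :=
    { toFun := fun x => WithLp.toLp 2 (hat τ x, rightMul hτ x ζ)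
      map_add' := fun x y => by
        rw [hat_add, rightMul_add, ← WithLp.toLp_add]; rfl
      map_smul' := fun c x => by
        rw [hat_smul, rightMul_smul, RingHom.id_apply, ← WithLp.toLp_smul]; rfl }
  let S := (LinearMap.range g).topologicalClosure
  have : CompleteSpace S := (LinearMap.range g).isClosed_topologicalClosure.completeSpace_coe
  let w : WithLp 2 (L2 τ × L2 τ) := WithLp.toLp 2 (ξ, 0)
  let p := S.starProjection w
  have hpS : p ∈ S := S.starProjection_apply_mem w
  refine ⟨p.fst, p.snd, ?_, fun y => ?_⟩
  · have hcont : Continuous (WithLp.ofLp : WithLp 2 (L2 τ × L2 τ) → _) :=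
      WithLp.prod_continuous_ofLp 2 _ _
    refine map_mem_closure (f := WithLp.ofLp) hcont
      (s := (LinearMap.range g : Set (WithLp 2 (L2 τ × L2 τ)))) hpS ?_
    rintro _ ⟨x, rfl⟩
    exact ⟨x, rfl⟩
  · have h := S.starProjection_inner_eq_zero w (g y)
      ((LinearMap.range g).le_topologicalClosure ⟨y, rfl⟩)
    have h' : ⟪g y, w - p⟫_ℂ = 0 := by rw [← inner_conj_symm, h, map_zero]
    rw [WithLp.prod_inner_apply] at h'
    have h'' : ⟪hat τ y, ξ - p.fst⟫_ℂ + ⟪rightMul hτ y ζ, 0 - p.snd⟫_ℂ = 0 := h'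
    rw [zero_sub, inner_neg_right, add_neg_eq_zero] at h''
    exact h''

namespace IsGraphProj

theorem inner_eq {ζ ξ β γ β' γ' : L2 τ} (h : IsGraphProj hτ ζ ξ β γ)
    (h' : (β', γ') ∈ graph hτ ζ) : ⟪β', ξ - β⟫_ℂ = ⟪γ', γ⟫_ℂ := by
  have hc : IsClosed {p : L2 τ × L2 τ | ⟪p.1, ξ - β⟫_ℂ = ⟪p.2, γ⟫_ℂ} :=
    isClosed_eq (by fun_prop) (by fun_prop)
  refine closure_minimal ?_ hc h'
  rintro _ ⟨x, rfl⟩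
  exact h.orth x

theorem norm_sq_add {ζ ξ β γ : L2 τ} (h : IsGraphProj hτ ζ ξ β γ) :
    ‖β‖ ^ 2 + ‖γ‖ ^ 2 ≤ ‖β‖ * ‖ξ‖ := by
  have h1 := congrArg Complex.re (h.inner_eq h.mem)
  rw [inner_sub_right, Complex.sub_re] at h1
  have h2 : ∀ v : L2 τ, (⟪v, v⟫_ℂ).re = ‖v‖ ^ 2 := fun v => inner_self_eq_norm_sq (𝕜 := ℂ) v
  rw [h2, h2] at h1
  have h3 : (⟪β, ξ⟫_ℂ).re ≤ ‖β‖ * ‖ξ‖ := (Complex.re_le_norm _).trans (norm_inner_le_norm _ _)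
  linarith

theorem norm_left_le {ζ ξ β γ : L2 τ} (h : IsGraphProj hτ ζ ξ β γ) : ‖β‖ ≤ ‖ξ‖ := by
  have := h.norm_sq_add
  by_contra! hlt
  nlinarith [norm_nonneg β, norm_nonneg ξ, sq_nonneg ‖γ‖]

theorem norm_right_le {ζ ξ β γ : L2 τ} (h : IsGraphProj hτ ζ ξ β γ) : ‖γ‖ ≤ ‖ξ‖ := by
  have h1 := h.norm_sq_add
  have h2 := h.norm_left_le
  refine abs_le_of_sq_le_sq' (a := ‖γ‖) ?_ (norm_nonneg _) |>.2
  nlinarith [norm_nonneg β, norm_nonneg ξ]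

theorem unique {ζ ξ β γ β' γ' : L2 τ} (h : IsGraphProj hτ ζ ξ β γ)
    (h' : IsGraphProj hτ ζ ξ β' γ') : β = β' ∧ γ = γ' := by
  have e1 : ⟪β, β - β'⟫_ℂ + ⟪γ, γ - γ'⟫_ℂ = 0 := by
    have a := h.inner_eq h.mem
    have b := h'.inner_eq h.mem
    simp only [inner_sub_right] at *
    linear_combination b - a
  have e2 : ⟪β', β - β'⟫_ℂ + ⟪γ', γ - γ'⟫_ℂ = 0 := by
    have a := h.inner_eq h'.mem
    have b := h'.inner_eq h'.mem
    simp only [inner_sub_right] at *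
    linear_combination b - a
  have e3 : ⟪β - β', β - β'⟫_ℂ + ⟪γ - γ', γ - γ'⟫_ℂ = 0 := by
    rw [inner_sub_left, inner_sub_left]
    linear_combination e1 - e2
  have h2 : ∀ v : L2 τ, (⟪v, v⟫_ℂ).re = ‖v‖ ^ 2 := fun v => inner_self_eq_norm_sq (𝕜 := ℂ) v
  have e4 := congrArg Complex.re e3
  rw [Complex.add_re, h2, h2, Complex.zero_re] at e4
  have hβ : ‖β - β'‖ = 0 := by nlinarith [sq_nonneg ‖β - β'‖, sq_nonneg ‖γ - γ'‖]
  have hγ : ‖γ - γ'‖ = 0 := by nlinarith [sq_nonneg ‖β - β'‖, sq_nonneg ‖γ - γ'‖]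
  exact ⟨sub_eq_zero.mp (norm_eq_zero.mp hβ), sub_eq_zero.mp (norm_eq_zero.mp hγ)⟩

/-- If `S ⊕ T` and its adjoint both preserve the graph of `ζ`, they commute with the projection
onto it. -/
theorem map {ζ ξ β γ : L2 τ} (h : IsGraphProj hτ ζ ξ β γ) (S T : L2 τ →L[ℂ] L2 τ)
    (hST : ∀ x, ∃ y, S (hat τ x) = hat τ y ∧ T (rightMul hτ x ζ) = rightMul hτ y ζ)
    (hST' : ∀ x, ∃ y, star S (hat τ x) = hat τ y ∧ star T (rightMul hτ x ζ) = rightMul hτ y ζ) :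
    IsGraphProj hτ ζ (S ξ) (S β) (T γ) where
  mem := by
    refine map_mem_closure (f := Prod.map S T) (S.continuous.prodMap T.continuous) h.mem ?_
    rintro _ ⟨x, rfl⟩
    obtain ⟨y, h1, h2⟩ := hST x
    exact ⟨y, by simp [h1, h2]⟩
  orth y := by
    obtain ⟨z, h1, h2⟩ := hST' y
    rw [ContinuousLinearMap.star_eq_adjoint] at h1 h2
    rw [← map_sub, ← ContinuousLinearMap.adjoint_inner_left, h1,
      ← ContinuousLinearMap.adjoint_inner_left, h2, h.orth]

theorem map_rightMul {ζ ξ β γ : L2 τ} (h : IsGraphProj hτ ζ ξ β γ) (d : N) :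
    IsGraphProj hτ ζ (rightMul hτ d ξ) (rightMul hτ d β) (rightMul hτ d γ) := by
  refine h.map _ _ (fun x => ⟨x * d, rightMul_hat hτ d x, (rightMul_mul_apply hτ x d ζ).symm⟩)
    (fun x => ⟨x * star d, ?_, ?_⟩)
  · rw [star_rightMul, rightMul_hat]
  · rw [star_rightMul, rightMul_mul_apply]

theorem map_leftMul {ζ ξ β γ : L2 τ} (h : IsGraphProj hτ ζ ξ β γ) {a d : N}
    (had : leftMul τ a ζ = rightMul hτ d ζ)
    (had' : leftMul τ (star a) ζ = rightMul hτ (star d) ζ) :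
    IsGraphProj hτ ζ (leftMul τ d ξ) (leftMul τ d β) (leftMul τ a γ) := by
  refine h.map _ _ (fun x => ⟨d * x, leftMul_hat τ d x, ?_⟩) (fun x => ⟨star d * x, ?_, ?_⟩)
  · rw [leftMul_rightMul, had, rightMul_mul_apply]
  · rw [star_leftMul, leftMul_hat]
  · rw [star_leftMul, leftMul_rightMul, had', rightMul_mul_apply]

end IsGraphProj

/-- The operator `x̂ ↦ ζ x` is closable, and `b̂` is in the domain of its closure only with
value `ζ b`. -/
theorem rightMul_eq_of_mem_graph {ζ γ : L2 τ} {b : N} (h : (hat τ b, γ) ∈ graph hτ ζ) :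
    rightMul hτ b ζ = γ := by
  obtain ⟨s, hs, hsl⟩ := mem_closure_iff_seq_limit.mp h
  choose x hx using hs
  obtain rfl : (fun n => (hat τ (x n), rightMul hτ (x n) ζ)) = s := funext hx
  have h1 : Tendsto (fun n => hat τ (x n)) atTop (𝓝 (hat τ b)) := (continuous_fst.tendsto _).comp hsl
  have h2 : Tendsto (fun n => rightMul hτ (x n) ζ) atTop (𝓝 γ) := (continuous_snd.tendsto _).comp hsl
  have h3 : Tendsto (fun n => hat τ (star (x n))) atTop (𝓝 (hat τ (star b))) := by
    rw [tendsto_iff_norm_sub_tendsto_zero] at h1 ⊢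
    refine h1.congr fun n => ?_
    rw [← hat_sub, ← hat_sub, ← star_sub, norm_hat_star hτ]
  refine ext_hat τ fun y => tendsto_nhds_unique ?_ ((tendsto_const_nhds (x := hat τ y)).inner h2)
  have e : ∀ z : N, ⟪hat τ y, rightMul hτ z ζ⟫_ℂ = ⟪leftMul τ y (hat τ (star z)), ζ⟫_ℂ := fun z => by
    rw [inner_rightMul, rightMul_hat, leftMul_hat]
  simp_rw [e]
  exact (((leftMul τ y).continuous.tendsto _).comp h3).inner tendsto_const_nhds

/-- Every `ζ ∈ L²(N, τ)` is a fraction `c b⁻¹` with `b, c ∈ N`, `ζ b = c`. With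
`b = (1 + ζ⋆ζ)⁻¹`, right multiplication by `b` is injective, and `b`, `c` inherit the commutation
relations of `ζ`. -/
theorem exists_rightMul_eq_hat (ζ : L2 τ) : ∃ b c : N, star b = b ∧ b = b * b + star c * c ∧
    rightMul hτ b ζ = hat τ c ∧ (∀ η, rightMul hτ b η = 0 → η = 0) ∧
    ∀ a d : N, leftMul τ a ζ = rightMul hτ d ζ → leftMul τ (star a) ζ = rightMul hτ (star d) ζ →
      d * b = b * d ∧ a * c = c * d := by
  obtain ⟨β, γ, h⟩ := exists_isGraphProj (hτ := hτ) ζ (hat τ 1)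
  obtain ⟨b, rfl⟩ := exists_hat_eq_of_leftBounded hτ (β := β) fun x => by
    simpa [rightMul_hat_one] using (h.map_rightMul x).norm_left_le
  obtain ⟨c, rfl⟩ := exists_hat_eq_of_leftBounded hτ (β := γ) fun x => by
    simpa [rightMul_hat_one] using (h.map_rightMul x).norm_right_le
  have hx : ∀ x, IsGraphProj hτ ζ (hat τ x) (hat τ (b * x)) (hat τ (c * x)) := fun x => by
    simpa [rightMul_hat] using h.map_rightMul x
  have hb1 : star b * (1 - b) = star c * c := by
    refine hat_injective hτ (ext_hat τ fun y => ?_)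
    have := h.inner_eq (hx y).mem
    rw [← hat_sub, inner_hat, inner_hat, star_mul, star_mul, mul_assoc, mul_assoc] at this
    rw [inner_hat, inner_hat, this]
  have hb2 : star b = star b * b + star c * c := by
    rw [← hb1, mul_sub, mul_one]; abel
  have hbs : star b = b := by
    conv_rhs => rw [← star_star b, hb2]
    simp only [star_add, star_mul, star_star]
    exact hb2
  have hb3 : b = b * b + star c * c := by rwa [hbs] at hb2
  have hζb : rightMul hτ b ζ = hat τ c := rightMul_eq_of_mem_graph h.mem
  have hinj : ∀ η, leftMul τ b η = 0 → η = 0 := by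
    intro η hη
    have hc : leftMul τ c η = 0 := by
      rw [← inner_self_eq_zero (𝕜 := ℂ), inner_leftMul, ← leftMul_mul_apply,
        show star c * c = b - b * b by rw [eq_sub_iff_add_eq, add_comm, ← hb3], leftMul_sub,
        sub_apply, leftMul_mul_apply, hη, map_zero, sub_zero, inner_zero_left]
    refine ext_hat τ fun y => ?_
    have horth : ∀ v : L2 τ, ⟪hat τ y, v - leftMul τ b v⟫_ℂ = ⟪rightMul hτ y ζ, leftMul τ c v⟫_ℂ := by
      intro v
      refine (denseRange_hat τ).induction_on (p := fun v => ⟪hat τ y, v - leftMul τ b v⟫_ℂ =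
        ⟪rightMul hτ y ζ, leftMul τ c v⟫_ℂ) v (isClosed_eq (by fun_prop) (by fun_prop)) fun x => ?_
      rw [leftMul_hat, leftMul_hat]
      exact (hx x).orth y
    have := horth η
    rwa [hη, hc, sub_zero, inner_zero_right, ← inner_zero_right (hat τ y)] at this
  have hdense : DenseRange (leftMul τ b) := by
    have : (LinearMap.range (leftMul τ b).toLinearMap).topologicalClosure = ⊤ := by
      rw [Submodule.topologicalClosure_eq_top_iff, Submodule.eq_bot_iff]
      intro η hη
      refine hinj η (ext_inner_left ℂ fun v => ?_)
      rw [inner_leftMul, hbs, inner_zero_right]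
      exact hη _ ⟨v, rfl⟩
    exact Submodule.dense_iff_topologicalClosure_eq_top.mpr this
  refine ⟨b, c, hbs, hb3, hζb, fun η hη => ?_, fun a d h1 h2 => ?_⟩
  · -- `⟪ŷ, η⟫ = 0` since `y⋆` is a limit of elements `b x` and `x⋆ b ⟂ η`
    refine ext_hat τ fun y => ?_
    obtain ⟨s, hs, hsl⟩ := mem_closure_iff_seq_limit.mp
      ((hdense.comp (denseRange_hat τ) (leftMul τ b).continuous) (hat τ (star y)))
    choose x hx using hs
    have h1 : Tendsto (fun n => hat τ (star (x n) * b)) atTop (𝓝 (hat τ y)) := by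
      rw [tendsto_iff_norm_sub_tendsto_zero] at hsl ⊢
      refine hsl.congr fun n => ?_
      rw [← hx, Function.comp_apply, leftMul_hat, ← hat_sub, ← hat_sub, ← norm_hat_star hτ, star_sub,
        star_star, star_mul, hbs]
    refine tendsto_nhds_unique (h1.inner (tendsto_const_nhds (x := η))) ?_
    rw [inner_zero_right]
    refine tendsto_const_nhds.congr fun n => ?_
    have := inner_rightMul hτ b (hat τ (star (x n))) η
    rw [hη, inner_zero_right, hbs, rightMul_hat] at this
    exact this
  · have e := (h.map_leftMul h1 h2).unique (by simpa [leftMul_hat_one] using hx d)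
    rw [leftMul_hat, leftMul_hat] at e
    exact ⟨hat_injective hτ e.1, hat_injective hτ e.2⟩

end Graph

/-! ### Polar decomposition and support projections -/

section Polar

variable {H : Type*} [NormedAddCommGroup H] [InnerProductSpace ℂ H] [CompleteSpace H]

/-- `H` is the orthogonal sum of the kernel and the closed range of a self-adjoint `h`. -/
theorem eq_of_mul_eq_of_eqOn_ker {h S T : H →L[ℂ] H} (hs : star h = h) (h1 : S * h = T * h)
    (h2 : ∀ x, h x = 0 → S x = T x) : S = T := by
  let M := (LinearMap.range h.toLinearMap).topologicalClosure
  have : CompleteSpace M := (LinearMap.range h.toLinearMap).isClosed_topologicalClosure.completeSpace_coe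
  have hM : ∀ x ∈ M, S x = T x := by
    intro x hx
    refine closure_minimal (t := {x | S x = T x}) ?_
      (isClosed_eq S.continuous T.continuous) hx
    rintro _ ⟨y, rfl⟩
    exact congrArg (· y) h1
  ext x
  have hk : h (x - M.starProjection x) = 0 := by
    refine ext_inner_left ℂ fun v => ?_
    rw [inner_zero_right, ← ContinuousLinearMap.adjoint_inner_left,
      ← ContinuousLinearMap.star_eq_adjoint, hs, ← inner_conj_symm,
      M.starProjection_inner_eq_zero x (h v)
        ((LinearMap.range h.toLinearMap).le_topologicalClosure ⟨v, rfl⟩), map_zero]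
  have e1 := h2 _ hk
  have e2 := hM _ (M.starProjection_apply_mem x)
  rw [map_sub, map_sub, e2] at e1
  exact sub_left_injective e1

/-- Polar decomposition `c = V h` with `h` self-adjoint and `h² = c⋆ c`. The last clause expresses
that `V` lies in every von Neumann algebra that contains `c` and `h`. -/
theorem exists_polar {c h : H →L[ℂ] H} (hs : star h = h) (hch : star c * c = h * h) :
    ∃ V : H →L[ℂ] H, V * h = c ∧ (∀ x, h x = 0 → V x = 0) ∧ V * star V * V = V ∧
      star V * V * h = h ∧ ∀ g k : H →L[ℂ] H, h * g = g * h → k * c = c * g → k * V = V * g := by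
  let R := LinearMap.range h.toLinearMap
  let M := R.topologicalClosure
  have : CompleteSpace M := R.isClosed_topologicalClosure.completeSpace_coe
  let e : H →ₗ[ℂ] M := h.toLinearMap.codRestrict M fun x => R.le_topologicalClosure ⟨x, rfl⟩
  have he : DenseRange e := by
    intro x
    rw [Topology.IsInducing.subtypeVal.closure_eq_preimage_closure_image, Set.mem_preimage,
      ← Set.range_comp]
    exact x.2
  have hinner : ∀ x y, ⟪c x, c y⟫_ℂ = ⟪h x, h y⟫_ℂ := by
    intro x y
    have e1 := congrArg (fun S : H →L[ℂ] H => ⟪x, S y⟫_ℂ)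
      (hch.trans (by rw [hs]) : star c * c = star h * h)
    simp only [mul_apply_eq_comp] at e1
    simpa only [ContinuousLinearMap.star_eq_adjoint, ContinuousLinearMap.adjoint_inner_right] using e1
  have hnorm : ∀ x, ‖c x‖ ≤ 1 * ‖e x‖ := by
    intro x
    have e1 := congrArg Complex.re (hinner x x)
    have h2 : ∀ v : H, (⟪v, v⟫_ℂ).re = ‖v‖ ^ 2 := fun v => inner_self_eq_norm_sq (𝕜 := ℂ) v
    rw [h2, h2] at e1
    rw [one_mul]
    exact ((sq_eq_sq₀ (norm_nonneg _) (norm_nonneg _)).mp e1).le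
  let V : H →L[ℂ] H := (c.toLinearMap.extendOfNorm e) ∘L M.orthogonalProjectionOnto
  have hVh : V * h = c := by
    ext x
    have e1 : M.orthogonalProjectionOnto (h x) = e x :=
      M.orthogonalProjectionOnto_mem_subspace_eq_self (e x)
    change c.toLinearMap.extendOfNorm e (M.orthogonalProjectionOnto (h x)) = c x
    rw [e1, LinearMap.extendOfNorm_eq he ⟨1, hnorm⟩]
    rfl
  have hVk : ∀ x, h x = 0 → V x = 0 := by
    intro x hx
    have e1 : M.orthogonalProjectionOnto x = 0 := by
      rw [Submodule.orthogonalProjectionOnto_eq_zero_iff, Submodule.orthogonal_closure]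
      rintro _ ⟨y, rfl⟩
      change ⟪h y, x⟫_ℂ = 0
      rw [← hs, ContinuousLinearMap.star_eq_adjoint, ContinuousLinearMap.adjoint_inner_left, hx,
        inner_zero_right]
    change c.toLinearMap.extendOfNorm e (M.orthogonalProjectionOnto x) = 0
    rw [e1, map_zero]
  have hVVh : star V * V * h = h := by
    rw [mul_assoc, hVh, ← star_inj]
    refine eq_of_mul_eq_of_eqOn_ker hs ?_ fun x hx => ?_
    · rw [star_mul, star_star, mul_assoc, hVh, hch, hs]
    · rw [star_mul, star_star, mul_apply_eq_comp, hVk x hx, map_zero, hs, hx]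
  refine ⟨V, hVh, hVk, ?_, hVVh, fun g k hg hk => ?_⟩
  · refine eq_of_mul_eq_of_eqOn_ker hs ?_ fun x hx => ?_
    · rw [mul_assoc V, mul_assoc V, hVVh]
    · rw [mul_apply_eq_comp, hVk x hx, map_zero]
  · refine eq_of_mul_eq_of_eqOn_ker hs ?_ fun x hx => ?_
    · rw [mul_assoc, hVh, hk, mul_assoc, ← hg, ← mul_assoc, hVh]
    · have e1 : h (g x) = 0 := by
        have := congrArg (· x) hg
        simpa [hx] using this
      rw [mul_apply_eq_comp, mul_apply_eq_comp, hVk x hx, hVk _ e1, map_zero]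

/-- Every self-adjoint element of a von Neumann algebra has a support projection in it. -/
theorem exists_support (A : VonNeumannAlgebra H) {h : H →L[ℂ] H} (hA : h ∈ A) (hs : star h = h) :
    ∃ p ∈ A, star p = p ∧ p * p = p ∧ p * h = h ∧ h * p = h ∧ ∀ g, h * g = 0 → p * g = 0 := by
  obtain ⟨p, hp, hpk, hppp, hpph, hpc⟩ := exists_polar (c := h) hs (by rw [hs])
  have hsp : star p * p = p := eq_of_mul_eq_of_eqOn_ker hs (by rw [hpph, hp]) fun x hx => by
    rw [mul_apply_eq_comp, hpk x hx, map_zero]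
  have hps : star p = p := by rw [← hsp, star_mul, star_star]
  refine ⟨p, ?_, hps, by rwa [hps] at hsp, hp, ?_, fun g hg => ?_⟩
  · rw [← commutant_commutant A, mem_commutant_iff]
    intro g hg
    have := mem_commutant_iff.mp hg h hA
    exact hpc g g this this.symm
  · rw [← star_inj, star_mul, hs, hps, hp]
  · ext x
    exact hpk _ (congrArg (· x) hg)

end Polar

/-! ### Masas and the weak fundamental set -/

section Masa

variable {H : Type*} [NormedAddCommGroup H] [InnerProductSpace ℂ H] [CompleteSpace H]
variable {N A : VonNeumannAlgebra H}

theorem IsMasa.mem (hA : IsMasa N A) {x : H →L[ℂ] H} (hx : x ∈ A) : x ∈ N := hA.1.1 x hx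

theorem IsMasa.comm (hA : IsMasa N A) {x y : H →L[ℂ] H} (hx : x ∈ A) (hy : y ∈ A) :
    x * y = y * x := hA.1.2 x hx y hy

theorem IsMasa.comm' (hA : IsMasa N A) {x y : N} (hx : (x : H →L[ℂ] H) ∈ A)
    (hy : (y : H →L[ℂ] H) ∈ A) : x * y = y * x := Subtype.ext (hA.comm hx hy)

theorem IsMasa.mem_of_selfAdjoint (hA : IsMasa N A) {x : H →L[ℂ] H} (hx : x ∈ N)
    (hs : star x = x) (hc : ∀ a ∈ A, a * x = x * a) : x ∈ A := by
  let s : Set (H →L[ℂ] H) := insert x A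
  have hcomm : ∀ a ∈ s, ∀ b ∈ s, a * b = b * a := by
    rintro a (rfl | ha) b (rfl | hb)
    · rfl
    · exact (hc b hb).symm
    · exact hc a ha
    · exact hA.comm ha hb
  have hstar : ∀ a ∈ s, star a ∈ s := by
    rintro a (rfl | ha)
    · rw [hs]; exact Or.inl rfl
    · exact Or.inr (star_mem ha)
  have hsub : s ⊆ StarAlgebra.adjoin ℂ s := StarAlgebra.subset_adjoin ℂ s
  have := StarAlgebra.isMulCommutative_adjoin ℂ hcomm fun a ha b hb => hcomm a ha _ (hstar b hb)
  refine hA.2 (y := StarAlgebra.adjoin ℂ s) ⟨fun y hy => ?_, fun y hy z hz => ?_⟩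
    (fun a ha => hsub (Or.inr ha)) (hsub (Or.inl rfl))
  · refine (StarAlgebra.adjoin_le (S := N.toStarSubalgebra) ?_) hy
    rintro a (rfl | ha)
    · exact hx
    · exact hA.mem ha
  · exact congrArg Subtype.val
      (mul_comm' (⟨y, hy⟩ : StarAlgebra.adjoin ℂ s) ⟨z, hz⟩)

/-- A masa is its own relative commutant. -/
theorem IsMasa.mem_of_commute (hA : IsMasa N A) {x : N}
    (hc : ∀ a : N, (a : H →L[ℂ] H) ∈ A → a * x = x * a) : (x : H →L[ℂ] H) ∈ A := by
  have hc1 : ∀ a ∈ A, a * (x : H →L[ℂ] H) = x * a := fun a ha =>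
    congrArg Subtype.val (hc ⟨a, hA.mem ha⟩ ha)
  have hc2 : ∀ a ∈ A, a * star (x : H →L[ℂ] H) = star (x : H →L[ℂ] H) * a := fun a ha => by
    rw [← star_inj, star_mul, star_mul, star_star, hc1 _ (star_mem ha)]
  have h1 : ((realPart (x : H →L[ℂ] H) : H →L[ℂ] H)) ∈ A := by
    refine hA.mem_of_selfAdjoint ?_ (realPart (x : H →L[ℂ] H)).2 fun a ha => ?_
    · rw [realPart_apply_coe]
      exact N.toStarSubalgebra.smul_mem (add_mem x.2 (star_mem x.2)) ((2⁻¹ : ℝ) : ℂ)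
    · rw [realPart_apply_coe, mul_smul_comm, smul_mul_assoc, mul_add, add_mul, hc1 a ha, hc2 a ha]
  have h2 : ((imaginaryPart (x : H →L[ℂ] H) : H →L[ℂ] H)) ∈ A := by
    refine hA.mem_of_selfAdjoint ?_ (imaginaryPart (x : H →L[ℂ] H)).2 fun a ha => ?_
    · rw [imaginaryPart_apply_coe]
      exact N.toStarSubalgebra.smul_mem (N.toStarSubalgebra.smul_mem
        (sub_mem x.2 (star_mem x.2)) ((2⁻¹ : ℝ) : ℂ)) (-Complex.I)
    · rw [imaginaryPart_apply_coe, mul_smul_comm, smul_mul_assoc, mul_smul_comm, smul_mul_assoc,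
        mul_sub, sub_mul, hc1 a ha, hc2 a ha]
  rw [← realPart_add_I_smul_imaginaryPart (x : H →L[ℂ] H)]
  exact add_mem h1 (SMulMemClass.smul_mem _ h2)

end Masa

section L2Masa

variable {H : Type*} [NormedAddCommGroup H] [InnerProductSpace ℂ H] [CompleteSpace H]
variable {N A : VonNeumannAlgebra H} {τ : N →ₚ[ℂ] ℂ}

theorem hat_mem_L2Of {S : Set (H →L[ℂ] H)} {x : N} (hx : (x : H →L[ℂ] H) ∈ S) :
    hat τ x ∈ L2Of τ S :=
  Submodule.le_topologicalClosure _ (Submodule.subset_span ⟨x, hx, rfl⟩)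

theorem isClosed_L2Of (S : Set (H →L[ℂ] H)) : IsClosed (L2Of τ S : Set (L2 τ)) :=
  Submodule.isClosed_topologicalClosure _

instance instCompleteSpaceL2Of (S : Set (H →L[ℂ] H)) : CompleteSpace (L2Of τ S) :=
  (isClosed_L2Of S).completeSpace_coe

theorem L2Of_le {S : Set (H →L[ℂ] H)} {M : Submodule ℂ (L2 τ)} (hM : IsClosed (M : Set (L2 τ)))
    (h : ∀ x : N, (x : H →L[ℂ] H) ∈ S → hat τ x ∈ M) : L2Of τ S ≤ M := by
  refine Submodule.topologicalClosure_minimal _ (Submodule.span_le.mpr ?_) hM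
  rintro _ ⟨x, hx, rfl⟩
  exact h x hx

variable (hτ : IsFaithfulNormalTracialState τ) (hA : IsMasa N A)
include hτ hA

theorem leftMul_eq_rightMul_of_mem {ξ : L2 τ} (hξ : ξ ∈ L2Of τ (A : Set (H →L[ℂ] H))) {a : N}
    (ha : (a : H →L[ℂ] H) ∈ A) : leftMul τ a ξ = rightMul hτ a ξ := by
  have h : L2Of τ (A : Set (H →L[ℂ] H)) ≤ (leftMul τ a - rightMul hτ a).ker := by
    refine L2Of_le (leftMul τ a - rightMul hτ a).isClosed_ker fun x hx => ?_
    rw [LinearMap.mem_ker, ContinuousLinearMap.coe_coe, sub_apply, leftMul_hat,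
      rightMul_hat, hA.comm' ha hx, sub_self]
  exact sub_eq_zero.mp (h hξ)

/-- `L²(A, τ)` is the set of all vectors that commute with the masa `A`. A vector orthogonal to
`L²(A, τ)` that commutes with `A` is a fraction `c b⁻¹` with `b, c ∈ A`, hence `0`. -/
theorem mem_L2Of_iff_commute {ξ : L2 τ} : ξ ∈ L2Of τ (A : Set (H →L[ℂ] H)) ↔
    ∀ a : N, (a : H →L[ℂ] H) ∈ A → leftMul τ a ξ = rightMul hτ a ξ := by
  refine ⟨fun h a ha => leftMul_eq_rightMul_of_mem hτ hA h ha, fun h => ?_⟩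
  set M := L2Of τ (A : Set (H →L[ℂ] H)) with hM
  have hp : M.starProjection ξ ∈ M := M.starProjection_apply_mem ξ
  set ξ' := ξ - M.starProjection ξ with hξ'
  have hc : ∀ a : N, (a : H →L[ℂ] H) ∈ A → leftMul τ a ξ' = rightMul hτ a ξ' := fun a ha => by
    rw [hξ', map_sub, map_sub, h a ha, leftMul_eq_rightMul_of_mem hτ hA hp ha]
  obtain ⟨b, c, hbs, -, hbc, hinj, hcomm⟩ := exists_rightMul_eq_hat (hτ := hτ) ξ'
  have hcomm' := fun (a : N) (ha : (a : H →L[ℂ] H) ∈ A) =>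
    hcomm a a (hc a ha) (hc (star a) (star_mem ha))
  have hb : (b : H →L[ℂ] H) ∈ A := hA.mem_of_commute fun a ha => (hcomm' a ha).1
  have hcA : (c : H →L[ℂ] H) ∈ A := hA.mem_of_commute fun a ha => (hcomm' a ha).2
  have hc0 : rightMul hτ b ξ' = 0 := by
    rw [← inner_self_eq_zero (𝕜 := ℂ)]
    nth_rw 1 [hbc]
    rw [inner_rightMul, hbs, rightMul_hat, ← inner_conj_symm,
      M.starProjection_inner_eq_zero ξ _ (hat_mem_L2Of (mul_mem hcA hb)), map_zero]
  rw [sub_eq_zero.mp (hinj ξ' hc0)]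
  exact hp

/-- `L_a - R_d` is a normal operator, so its kernel is also that of its adjoint. -/
theorem leftMul_star_eq_of_leftMul_eq {a d : N} (ha : (a : H →L[ℂ] H) ∈ A)
    (hd : (d : H →L[ℂ] H) ∈ A) {ζ : L2 τ} (h : leftMul τ a ζ = rightMul hτ d ζ) :
    leftMul τ (star a) ζ = rightMul hτ (star d) ζ := by
  have ha' : star a * a = a * star a := hA.comm' (star_mem ha) ha
  have hd' : star d * d = d * star d := hA.comm' (star_mem hd) hd
  have e : leftMul τ a (leftMul τ (star a) ζ - rightMul hτ (star d) ζ) -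
      rightMul hτ d (leftMul τ (star a) ζ - rightMul hτ (star d) ζ) = 0 := by
    rw [map_sub, map_sub, ← leftMul_mul_apply, ← ha', leftMul_mul_apply, h, leftMul_rightMul,
      leftMul_rightMul, h, ← rightMul_mul_apply, ← rightMul_mul_apply, hd', sub_self]
  rw [← sub_eq_zero, ← inner_self_eq_zero (𝕜 := ℂ)]
  nth_rw 1 [inner_sub_left]
  rw [← inner_leftMul, ← inner_rightMul, ← inner_sub_right, e, inner_zero_right]

end L2Masa

section Groupoid

variable {H : Type*} [NormedAddCommGroup H] [InnerProductSpace ℂ H] [CompleteSpace H]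
variable {N A : VonNeumannAlgebra H} {v : N}

theorem conj_mem_of_mem_normalisingGroupoid (hv : v ∈ normalisingGroupoid N A) {a : N}
    (ha : (a : H →L[ℂ] H) ∈ A) : ((v * a * star v : N) : H →L[ℂ] H) ∈ A := by
  obtain ⟨-, -, h2, h3, -⟩ := hv
  have : ((v * a * star v : N) : H →L[ℂ] H) ∈
      (fun a : H →L[ℂ] H => v * a * star (v : H →L[ℂ] H)) '' A := ⟨a, ha, rfl⟩
  rw [h3] at this
  obtain ⟨b, hb, hbe⟩ := this
  rw [← hbe]
  exact mul_mem hb h2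

theorem star_conj_mem_of_mem_normalisingGroupoid (hv : v ∈ normalisingGroupoid N A) {a : N}
    (ha : (a : H →L[ℂ] H) ∈ A) : ((star v * a * v : N) : H →L[ℂ] H) ∈ A := by
  obtain ⟨h0, h1, -, h3, -⟩ := hv
  have : (a : H →L[ℂ] H) * (v * star (v : H →L[ℂ] H)) ∈
      (fun a : H →L[ℂ] H => a * (v * star (v : H →L[ℂ] H))) '' A := ⟨a, ha, rfl⟩
  rw [← h3] at this
  obtain ⟨b, hb, hbe⟩ := this
  have h0' : (v : H →L[ℂ] H) * star (v : H →L[ℂ] H) * v = v := congrArg Subtype.val h0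
  have e : ((star v * a * v : N) : H →L[ℂ] H) = ((star v * v : N) : H →L[ℂ] H) * b *
      ((star v * v : N) : H →L[ℂ] H) := by
    change star (v : H →L[ℂ] H) * a * v = star (v : H →L[ℂ] H) * v * b * (star (v : H →L[ℂ] H) * v)
    have hbe' : (v : H →L[ℂ] H) * b * star (v : H →L[ℂ] H) = a * (v * star (v : H →L[ℂ] H)) := hbe
    calc star (v : H →L[ℂ] H) * a * v
        = star (v : H →L[ℂ] H) * (a * (v * star (v : H →L[ℂ] H))) * v := by
          simp only [mul_assoc] at h0' ⊢; rw [h0']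
      _ = _ := by rw [← hbe']; simp only [mul_assoc]
  rw [e]
  exact mul_mem (mul_mem h1 hb) h1

theorem mul_eq_mul_star_conj (hA : IsMasa N A) (hv : v ∈ normalisingGroupoid N A) {a : N}
    (ha : (a : H →L[ℂ] H) ∈ A) : a * v = v * (star v * a * v) := by
  obtain ⟨h0, -, h2, -⟩ := hv
  have := hA.comm' ha h2
  calc a * v = a * (v * star v) * v := by rw [mul_assoc, h0]
    _ = _ := by rw [this]; simp only [mul_assoc]

theorem mul_eq_conj_mul (hA : IsMasa N A) (hv : v ∈ normalisingGroupoid N A) {a : N}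
    (ha : (a : H →L[ℂ] H) ∈ A) : v * a = v * a * star v * v := by
  obtain ⟨h0, h1, -⟩ := hv
  have := hA.comm' ha h1
  calc v * a = v * (star v * v * a) := by rw [← mul_assoc, ← mul_assoc, h0]
    _ = _ := by rw [← this]; simp only [mul_assoc]

end Groupoid

section WeakFundamentalSet

variable {H : Type*} [NormedAddCommGroup H] [InnerProductSpace ℂ H] [CompleteSpace H]
variable {N A : VonNeumannAlgebra H} {τ : N →ₚ[ℂ] ℂ}
variable (hτ : IsFaithfulNormalTracialState τ) (hA : IsMasa N A)
include hτ hA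

theorem leftMul_mem_weakFundamentalSet {v : N} (hv : v ∈ normalisingGroupoid N A) {ξ : L2 τ}
    (hξ : ξ ∈ L2Of τ (A : Set (H →L[ℂ] H))) : leftMul τ v ξ ∈ weakFundamentalSet hτ A := by
  have hcomm := (mem_L2Of_iff_commute hτ hA).mp hξ
  refine Set.Subset.antisymm ?_ ?_
  · rintro _ ⟨a, ha, rfl⟩
    have hd := star_conj_mem_of_mem_normalisingGroupoid hv ha
    refine ⟨star v * a * v, hd, ?_⟩
    simp only
    rw [← leftMul_rightMul, ← hcomm _ hd, ← leftMul_mul_apply, ← leftMul_mul_apply,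
      ← mul_eq_mul_star_conj hA hv ha]
  · rintro _ ⟨a, ha, rfl⟩
    refine ⟨v * a * star v, conj_mem_of_mem_normalisingGroupoid hv ha, ?_⟩
    simp only
    rw [← leftMul_rightMul, ← hcomm _ ha, ← leftMul_mul_apply, ← leftMul_mul_apply,
      ← mul_eq_conj_mul hA hv ha]

/-- Polar decomposition of `ζ ∈ N₂ᶠ(A)`: if `ζ b = c` with `b, c ∈ N`, the polar part `v` of `c` is
that of `ζ`, and it inherits the commutation relations `a ζ = ζ d`. -/
theorem exists_eq_leftMul_of_mem_weakFundamentalSet {ζ : L2 τ}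
    (hζ : ζ ∈ weakFundamentalSet hτ A) : ∃ ξ ∈ L2Of τ (A : Set (H →L[ℂ] H)),
      ∃ v ∈ normalisingGroupoid N A, ζ = leftMul τ v ξ := by
  have hζ' : (fun a : N => leftMul τ a ζ) '' {a : N | (a : H →L[ℂ] H) ∈ A} =
    (fun a : N => rightMul hτ a ζ) '' {a : N | (a : H →L[ℂ] H) ∈ A} := hζ
  have hright : ∀ a : N, (a : H →L[ℂ] H) ∈ A → ∃ d : N, (d : H →L[ℂ] H) ∈ A ∧
      leftMul τ a ζ = rightMul hτ d ζ := fun a ha => by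
    obtain ⟨d, hd, h⟩ := hζ'.subset ⟨a, ha, rfl⟩
    exact ⟨d, hd, h.symm⟩
  have hleft : ∀ d : N, (d : H →L[ℂ] H) ∈ A → ∃ a : N, (a : H →L[ℂ] H) ∈ A ∧
      leftMul τ a ζ = rightMul hτ d ζ := fun d hd => hζ'.superset ⟨d, hd, rfl⟩
  obtain ⟨b, c, hbs, hbb, hbc, hinj, hcomm⟩ := exists_rightMul_eq_hat (hτ := hτ) ζ
  have hcomm' : ∀ a d : N, (a : H →L[ℂ] H) ∈ A → (d : H →L[ℂ] H) ∈ A →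
      leftMul τ a ζ = rightMul hτ d ζ → d * b = b * d ∧ a * c = c * d := fun a d ha hd h =>
    hcomm a d h (leftMul_star_eq_of_leftMul_eq hτ hA ha hd h)
  have hbA : (b : H →L[ℂ] H) ∈ A := hA.mem_of_commute fun d hd => by
    obtain ⟨a, ha, h⟩ := hleft d hd
    exact (hcomm' a d ha hd h).1
  have hccA : star (c : H →L[ℂ] H) * c ∈ A := by
    have : star c * c = b - b * b := by rw [eq_sub_iff_add_eq, add_comm, ← hbb]
    have h1 : star (c : H →L[ℂ] H) * c = (b : H →L[ℂ] H) - b * b := congrArg Subtype.val this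
    rw [h1]
    exact sub_mem hbA (mul_mem hbA hbA)
  let z : A := ⟨star (c : H →L[ℂ] H) * c, hccA⟩
  have hz : 0 ≤ z := star_mul_self_nonneg (c : H →L[ℂ] H)
  have hh0 : star (CFC.sqrt z) = CFC.sqrt z :=
    (IsSelfAdjoint.of_nonneg (CFC.sqrt_nonneg z)).star_eq
  obtain ⟨h, hhA, hhs, hhh⟩ : ∃ h : H →L[ℂ] H, h ∈ A ∧ star h = h ∧
      star (c : H →L[ℂ] H) * c = h * h :=
    ⟨((CFC.sqrt z : A) : H →L[ℂ] H), (CFC.sqrt z).2, congrArg Subtype.val hh0,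
      (congrArg Subtype.val (CFC.sqrt_mul_sqrt_self z hz)).symm⟩
  obtain ⟨V, hVh, -, hVVV, -, hVc⟩ := exists_polar hhs hhh
  have hVN : V ∈ N := by
    rw [← commutant_commutant N, mem_commutant_iff]
    intro g hg
    have hg' := mem_commutant_iff.mp hg
    exact hVc g g (hg' h (hA.mem hhA)) (hg' c c.2).symm
  let v : N := ⟨V, hVN⟩
  have hvvv : v * star v * v = v := Subtype.ext hVVV
  have hv : ∀ a d : N, (a : H →L[ℂ] H) ∈ A → (d : H →L[ℂ] H) ∈ A →
      leftMul τ a ζ = rightMul hτ d ζ → a * v = v * d := fun a d ha hd h =>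
    Subtype.ext (hVc d a (hA.comm hhA hd) (congrArg Subtype.val (hcomm' a d ha hd h).2))
  have hv' : ∀ a d : N, (a : H →L[ℂ] H) ∈ A → (d : H →L[ℂ] H) ∈ A →
      leftMul τ a ζ = rightMul hτ d ζ → d * star v = star v * a := fun a d ha hd h => by
    have := hv (star a) (star d) (star_mem ha) (star_mem hd)
      (leftMul_star_eq_of_leftMul_eq hτ hA ha hd h)
    rw [← star_inj, star_mul, star_mul, star_star, this]
  have hvA : ((star v * v : N) : H →L[ℂ] H) ∈ A := hA.mem_of_commute fun d hd => by
    obtain ⟨a, ha, h⟩ := hleft d hd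
    rw [← mul_assoc, hv' a d ha hd h, mul_assoc, hv a d ha hd h, mul_assoc]
  have hvA' : ((v * star v : N) : H →L[ℂ] H) ∈ A := hA.mem_of_commute fun a ha => by
    obtain ⟨d, hd, h⟩ := hright a ha
    rw [← mul_assoc, hv a d ha hd h, mul_assoc, hv' a d ha hd h, mul_assoc]
  refine ⟨leftMul τ (star v) ζ, (mem_L2Of_iff_commute hτ hA).mpr fun d hd => ?_, v,
    ⟨hvvv, hvA, hvA', ?_, ?_⟩, ?_⟩
  · obtain ⟨a, ha, h⟩ := hleft d hd
    rw [← leftMul_mul_apply, hv' a d ha hd h, leftMul_mul_apply, h, leftMul_rightMul]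
  · refine Set.Subset.antisymm ?_ ?_
    · rintro _ ⟨d, hd, rfl⟩
      obtain ⟨a, ha, h⟩ := hleft ⟨d, hA.mem hd⟩ hd
      refine ⟨a, ha, congrArg Subtype.val (?_ : a * (v * star v) = v * ⟨d, hA.mem hd⟩ * star v)⟩
      rw [← mul_assoc, hv a _ ha hd h]
    · rintro _ ⟨a, ha, rfl⟩
      obtain ⟨d, hd, h⟩ := hright ⟨a, hA.mem ha⟩ ha
      refine ⟨d, hd, congrArg Subtype.val (?_ : v * d * star v = ⟨a, hA.mem ha⟩ * (v * star v))⟩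
      rw [← mul_assoc, hv _ d ha hd h]
  · exact Set.image_congr fun a ha => hA.comm ha hvA'
  · rw [← leftMul_mul_apply, ← sub_eq_zero]
    refine hinj _ ?_
    have hvc : v * star v * c = c := by
      have hc : v * ⟨h, hA.mem hhA⟩ = c := Subtype.ext hVh
      rw [← hc, ← mul_assoc, hvvv]
    rw [map_sub, ← leftMul_rightMul, hbc, leftMul_hat, hvc, sub_self]

theorem mem_weakFundamentalSet_iff (ζ : L2 τ) : ζ ∈ weakFundamentalSet hτ A ↔
    ∃ ξ ∈ L2Of τ (A : Set (H →L[ℂ] H)), ∃ v ∈ normalisingGroupoid N A, ζ = leftMul τ v ξ := by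
  refine ⟨exists_eq_leftMul_of_mem_weakFundamentalSet hτ hA, ?_⟩
  rintro ⟨ξ, hξ, v, hv, rfl⟩
  exact leftMul_mem_weakFundamentalSet hτ hA hv hξ

end WeakFundamentalSet

/-! ### The bicommutant theorem in `‖·‖₂` -/

section Bicommutant

open scoped ENNReal

variable {ι : Type*}

theorem memℓp_two_iff {E : Type*} [NormedAddCommGroup E] {f : ι → E} : Memℓp f 2 ↔ Summable fun i => ‖f i‖ ^ 2 := by
  rw [memℓp_gen_iff (by norm_num)]
  norm_num

theorem norm_sq_eq_tsum {E : Type*} [NormedAddCommGroup E] (f : lp (fun _ : ι => E) 2) : ‖f‖ ^ 2 = ∑' i, ‖f i‖ ^ 2 := by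
  have := lp.norm_rpow_eq_tsum (p := 2) (by norm_num) f
  norm_num at this
  exact this

variable {H : Type*} [NormedAddCommGroup H] [InnerProductSpace ℂ H]

/-- The amplification `⨁ᵢ x` of a bounded operator `x` to `ℓ²(ι, H)`. -/
noncomputable def amplify (ι : Type*) (x : H →L[ℂ] H) :
    lp (fun _ : ι => H) 2 →L[ℂ] lp (fun _ : ι => H) 2 :=
  have hle (f : lp (fun _ : ι => H) 2) (i : ι) : ‖x (f i)‖ ^ 2 ≤ ‖x‖ ^ 2 * ‖f i‖ ^ 2 := by
    rw [← mul_pow]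
    exact pow_le_pow_left₀ (norm_nonneg _) (x.le_opNorm _) 2
  have hsum (f : lp (fun _ : ι => H) 2) : Summable fun i => ‖f i‖ ^ 2 :=
    memℓp_two_iff.mp (lp.memℓp f)
  have hmem (f : lp (fun _ : ι => H) 2) : Memℓp (fun i => x (f i)) 2 :=
    memℓp_two_iff.mpr (.of_nonneg_of_le (fun _ => by positivity) (hle f) ((hsum f).mul_left _))
  LinearMap.mkContinuous
    { toFun := fun f => ⟨fun i => x (f i), hmem f⟩
      map_add' := fun f g => by ext i; exact map_add x _ _
      map_smul' := fun c f => by ext i; exact map_smul x _ _ } ‖x‖ fun f => by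
    rw [← sq_le_sq₀ (norm_nonneg _) (by positivity), mul_pow, norm_sq_eq_tsum, norm_sq_eq_tsum,
      ← tsum_mul_left]
    exact (memℓp_two_iff.mp (hmem f)).tsum_le_tsum (hle f) ((hsum f).mul_left _)

@[simp]
theorem amplify_apply (x : H →L[ℂ] H) (f : lp (fun _ : ι => H) 2) (i : ι) :
    amplify ι x f i = x (f i) := rfl

theorem amplify_single [DecidableEq ι] (x : H →L[ℂ] H) (i : ι) (v : H) :
    amplify ι x (lp.single 2 i v) = lp.single 2 i (x v) := by
  ext j
  rw [amplify_apply, lp.single_apply, lp.single_apply]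
  rcases eq_or_ne i j with rfl | h
  · simp
  · simp [Pi.single_eq_of_ne h.symm]

variable [CompleteSpace H]

theorem inner_amplify (x : H →L[ℂ] H) (f g : lp (fun _ : ι => H) 2) :
    ⟪f, amplify ι x g⟫_ℂ = ⟪amplify ι (star x) f, g⟫_ℂ := by
  rw [lp.inner_eq_tsum, lp.inner_eq_tsum]
  refine tsum_congr fun i => ?_
  rw [amplify_apply, amplify_apply, ContinuousLinearMap.star_eq_adjoint,
    ContinuousLinearMap.adjoint_inner_left]

/-- The map `y ↦ (y Ξᵢ)ᵢ`. -/
noncomputable def orbitₗ (Ξ : lp (fun _ : ι => H) 2) : (H →L[ℂ] H) →ₗ[ℂ] lp (fun _ : ι => H) 2 where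
  toFun y := amplify ι y Ξ
  map_add' _ _ := by ext i; simp
  map_smul' _ _ := by ext i; simp

/-- Ultrastrong density of a unital self-adjoint semigroup in its bicommutant: the projection onto
the closure of `(span S) Ξ` has matrix coefficients in the commutant of `S`. -/
theorem amplify_mem_closure_of_mem_centralizer_centralizer {S : Set (H →L[ℂ] H)} (h1 : 1 ∈ S)
    (hmul : ∀ x ∈ S, ∀ y ∈ S, x * y ∈ S) (hstar : ∀ x ∈ S, star x ∈ S) {x : H →L[ℂ] H}
    (hx : x ∈ Set.centralizer (Set.centralizer S)) (Ξ : lp (fun _ : ι => H) 2) :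
    amplify ι x Ξ ∈ ((Submodule.span ℂ S).map (orbitₗ Ξ)).topologicalClosure := by
  classical
  set G := ((Submodule.span ℂ S).map (orbitₗ Ξ)).topologicalClosure with hG
  have : CompleteSpace G := (Submodule.isClosed_topologicalClosure _).completeSpace_coe
  have hSG : ∀ y ∈ S, amplify ι y Ξ ∈ G := fun y hy =>
    Submodule.le_topologicalClosure _ ⟨y, Submodule.subset_span hy, rfl⟩
  have hinv : ∀ u ∈ S, ∀ f ∈ G, amplify ι u f ∈ G := by
    intro u hu f hf
    have hle : G ≤ G.comap (amplify ι u).toLinearMap := by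
      refine Submodule.topologicalClosure_minimal _ ?_
        ((Submodule.isClosed_topologicalClosure _).preimage (amplify ι u).continuous)
      rw [Submodule.map_span_le]
      intro y hy
      exact hSG (u * y) (hmul u hu y hy)
    exact hle hf
  have hP : ∀ u ∈ S, ∀ f, G.starProjection (amplify ι u f) = amplify ι u (G.starProjection f) := by
    intro u hu f
    refine Submodule.eq_starProjection_of_mem_of_inner_eq_zero
      (hinv u hu _ (G.starProjection_apply_mem f)) fun g hg => ?_
    rw [← map_sub, ← inner_conj_symm, inner_amplify, ← inner_conj_symm,
      G.starProjection_inner_eq_zero f _ (hinv _ (hstar u hu) g hg), map_zero, map_zero]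
  -- the matrix coefficients of the projection commute with `S`, hence with `x`
  have hPx : amplify ι x ∘L G.starProjection = G.starProjection ∘L amplify ι x := by
    refine lp.ext_continuousLinearMap (by norm_num) fun j => ?_
    ext v i
    let T : H →L[ℂ] H := lp.evalCLM ℂ (fun _ => H) 2 i ∘L G.starProjection ∘L
      lp.singleContinuousLinearMap ℂ (fun _ => H) 2 j
    have hT : ∀ w, T w = G.starProjection (lp.single 2 j w) i := fun w => rfl
    have hTS : T ∈ Set.centralizer S := by
      intro u hu
      ext w
      rw [mul_apply_eq_comp, mul_apply_eq_comp, hT, hT, ← amplify_single, hP u hu, amplify_apply]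
    have e := congrArg (fun R : H →L[ℂ] H => R v) (hx T hTS)
    simp only [mul_apply_eq_comp, hT] at e
    rw [← amplify_single] at e
    exact e.symm
  have e := congrArg (fun R => R Ξ) hPx
  have hΞ : G.starProjection Ξ = Ξ := Submodule.starProjection_eq_self_iff.mpr (hSG 1 h1)
  simp only [ContinuousLinearMap.comp_apply, hΞ] at e
  rw [e]
  exact G.starProjection_apply_mem _

variable {N : VonNeumannAlgebra H} {τ : N →ₚ[ℂ] ℂ} (hτ : IsFaithfulNormalTracialState τ)
include hτ

/-- `‖·‖₂` is dominated by the norm of an orbit map `w ↦ (w Ξᵢ)ᵢ`. -/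
theorem exists_norm_hat_le_norm_amplify :
    ∃ Ξ : lp (fun _ : ℕ ⊕ ℕ => H) 2, ∀ w : N, ‖hat τ w‖ ≤ ‖amplify (ℕ ⊕ ℕ) (w : H →L[ℂ] H) Ξ‖ := by
  obtain ⟨ξ, η, hξ, hη, hs⟩ := hτ.normal
  have hmem : Memℓp (Sum.elim ξ η : ℕ ⊕ ℕ → H) 2 := by
    rw [memℓp_two_iff]
    exact Summable.sum _ hξ hη
  refine ⟨⟨Sum.elim ξ η, hmem⟩, fun w => ?_⟩
  obtain ⟨Ξ, hΞ, hΞl, hΞr⟩ : ∃ Ξ : lp (fun _ : ℕ ⊕ ℕ => H) 2, Ξ = ⟨Sum.elim ξ η, hmem⟩ ∧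
      (∀ n, Ξ (.inl n) = ξ n) ∧ ∀ n, Ξ (.inr n) = η n := ⟨_, rfl, fun _ => rfl, fun _ => rfl⟩
  rw [← hΞ]
  have hw : Summable fun i => ‖(w : H →L[ℂ] H) (Ξ i)‖ ^ 2 :=
    memℓp_two_iff.mp (lp.memℓp (amplify (ℕ ⊕ ℕ) (w : H →L[ℂ] H) Ξ))
  have hl : Summable fun n => ‖(w : H →L[ℂ] H) (ξ n)‖ ^ 2 := by
    simpa only [Function.comp_def, hΞl] using hw.comp_injective Sum.inl_injective
  have hr : Summable fun n => ‖(w : H →L[ℂ] H) (η n)‖ ^ 2 := by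
    simpa only [Function.comp_def, hΞr] using hw.comp_injective Sum.inr_injective
  have hsum : ‖amplify (ℕ ⊕ ℕ) (w : H →L[ℂ] H) Ξ‖ ^ 2 =
      ∑' n, (‖(w : H →L[ℂ] H) (ξ n)‖ ^ 2 + ‖(w : H →L[ℂ] H) (η n)‖ ^ 2) := by
    rw [norm_sq_eq_tsum, hl.tsum_add hr]
    refine (HasSum.sum (f := fun i => ‖(w : H →L[ℂ] H) (Ξ i)‖ ^ 2) ?_ ?_).tsum_eq
    · simpa only [Function.comp_def, hΞl] using hl.hasSum
    · simpa only [Function.comp_def, hΞr] using hr.hasSum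
  have hb : ‖τ (star w * w)‖ ≤ ‖amplify (ℕ ⊕ ℕ) (w : H →L[ℂ] H) Ξ‖ ^ 2 := by
    rw [hsum, ← (hs (star w * w)).tsum_eq]
    refine tsum_of_norm_bounded (hl.add hr).hasSum fun n => ?_
    have e : ⟪ξ n, ((star w * w : N) : H →L[ℂ] H) (η n)⟫_ℂ =
        ⟪(w : H →L[ℂ] H) (ξ n), (w : H →L[ℂ] H) (η n)⟫_ℂ := by
      change ⟪ξ n, (star (w : H →L[ℂ] H) * w) (η n)⟫_ℂ = _
      rw [mul_apply_eq_comp, ContinuousLinearMap.star_eq_adjoint,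
        ContinuousLinearMap.adjoint_inner_right]
    rw [e]
    refine (norm_inner_le_norm _ _).trans ?_
    nlinarith [sq_nonneg (‖(w : H →L[ℂ] H) (ξ n)‖ - ‖(w : H →L[ℂ] H) (η n)‖),
      sq_nonneg ‖(w : H →L[ℂ] H) (ξ n)‖, sq_nonneg ‖(w : H →L[ℂ] H) (η n)‖]
  rw [← norm_hat_sq, Complex.norm_real, Real.norm_of_nonneg (sq_nonneg _)] at hb
  exact (sq_le_sq₀ (norm_nonneg _) (norm_nonneg _)).mp hb

theorem L2Of_centralizer_centralizer_le {S : Set (H →L[ℂ] H)} (hSN : S ⊆ N) (h1 : 1 ∈ S)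
    (hmul : ∀ x ∈ S, ∀ y ∈ S, x * y ∈ S) (hstar : ∀ x ∈ S, star x ∈ S) :
    L2Of τ (Set.centralizer (Set.centralizer S)) ≤ L2Of τ S := by
  refine L2Of_le (isClosed_L2Of S) fun x hx => ?_
  obtain ⟨Ξ, hΞ⟩ := exists_norm_hat_le_norm_amplify hτ
  have hmem := amplify_mem_closure_of_mem_centralizer_centralizer h1 hmul hstar hx Ξ
  rw [← SetLike.mem_coe, ← (isClosed_L2Of S).closure_eq, Metric.mem_closure_iff]
  intro ε hε
  obtain ⟨_, ⟨y, hy, rfl⟩, hd⟩ := Metric.mem_closure_iff.mp hmem ε hε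
  have hspan : ∀ y ∈ Submodule.span ℂ S, ∃ z : N, (z : H →L[ℂ] H) = y ∧ hat τ z ∈ L2Of τ S := by
    intro y hy
    induction hy using Submodule.span_induction with
    | mem y hy => exact ⟨⟨y, hSN hy⟩, rfl, hat_mem_L2Of hy⟩
    | zero => exact ⟨0, rfl, by rw [hat_zero]; exact zero_mem _⟩
    | add y z _ _ hy hz =>
      obtain ⟨y, rfl, hy⟩ := hy
      obtain ⟨z, rfl, hz⟩ := hz
      exact ⟨y + z, rfl, by rw [hat_add]; exact add_mem hy hz⟩
    | smul c y _ hy =>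
      obtain ⟨y, rfl, hy⟩ := hy
      exact ⟨c • y, rfl, by rw [hat_smul]; exact Submodule.smul_mem _ c hy⟩
  obtain ⟨z, rfl, hz⟩ := hspan y hy
  refine ⟨hat τ z, hz, ?_⟩
  rw [dist_eq_norm, ← hat_sub]
  refine (hΞ (x - z)).trans_lt ?_
  rw [dist_eq_norm] at hd
  exact (congrArg norm ((orbitₗ Ξ).map_sub (x : H →L[ℂ] H) z)).trans_lt hd

end Bicommutant

/-! ### Projections of an abelian von Neumann algebra -/

section Projections

variable {H : Type*} [NormedAddCommGroup H] [InnerProductSpace ℂ H] [CompleteSpace H]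
variable {A : VonNeumannAlgebra H}

/-- One binary digit of a positive element: `p` is the spectral projection of `c` for
`(t/2, ∞)`. -/
theorem exists_projection_sub_nonneg_le (hcomm : ∀ x y : A, x * y = y * x) {c : A} {t : ℝ}
    (hc0 : 0 ≤ c) (hct : c ≤ algebraMap ℝ A (2 * t)) : ∃ p : A, star p = p ∧ p * p = p ∧
      0 ≤ c - algebraMap ℝ A t * p ∧ c - algebraMap ℝ A t * p ≤ algebraMap ℝ A t := by
  set s : A := algebraMap ℝ A t with hs
  have h2s : algebraMap ℝ A (2 * t) = s + s := by rw [two_mul, map_add]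
  have hss : IsSelfAdjoint s := IsSelfAdjoint.algebraMap A (IsSelfAdjoint.all t)
  have hd : IsSelfAdjoint (c - s) := (IsSelfAdjoint.of_nonneg hc0).sub hss
  set d := c - s with hdef
  obtain ⟨P, Q, hd1, hP, hQ, hPQ⟩ : ∃ P Q : A, P - Q = d ∧ 0 ≤ P ∧ 0 ≤ Q ∧ P * Q = 0 :=
    ⟨d⁺, d⁻, CFC.posPart_sub_negPart d hd, CFC.posPart_nonneg d, CFC.negPart_nonneg d,
      CFC.posPart_mul_negPart d⟩
  obtain ⟨p, hpA, hps, hpp, hp1, -, hp2⟩ := exists_support A P.2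
    (congrArg Subtype.val (IsSelfAdjoint.of_nonneg hP).star_eq)
  let q : A := ⟨p, hpA⟩
  have hqs : star q = q := Subtype.ext hps
  have hqq : q * q = q := Subtype.ext hpp
  have hq1 : q * P = P := Subtype.ext hp1
  have hq2 : q * Q = 0 := Subtype.ext (hp2 Q (congrArg Subtype.val hPQ))
  have hqd : q * d = P := by rw [← hd1, mul_sub, hq1, hq2, sub_zero]
  have hq' : (1 - q) * (1 - q) = 1 - q := by
    rw [mul_sub, mul_one, sub_mul, one_mul, hqq, sub_self, sub_zero]
  have hconj : ∀ {r : A}, r * r = r → ∀ x, r * x * r = r * x := fun hr x => by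
    rw [mul_assoc, hcomm x, ← mul_assoc, hr]
  refine ⟨q, hqs, hqq, ?_, ?_⟩
  · have e : c - s * q = (1 - q) * c * (1 - q) + P := by
      rw [hconj hq', ← hqd, hdef, hcomm s q]
      noncomm_ring
    rw [e]
    exact add_nonneg (IsSelfAdjoint.conjugate_nonneg hc0 ((IsSelfAdjoint.one A).sub hqs)) hP
  · have e : s - (c - s * q) = q * (s + s - c) * q + Q := by
      have e1 : Q = q * d - d := by rw [hqd, ← hd1]; abel
      rw [hconj hqq, e1, hdef, hcomm s q]
      noncomm_ring
    rw [← sub_nonneg, e]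
    refine add_nonneg (IsSelfAdjoint.conjugate_nonneg ?_ hqs) hQ
    rw [sub_nonneg, ← h2s]
    exact hct

/-- An abelian von Neumann algebra is the norm closed span of its projections: a positive element is
expanded in binary. -/
theorem eq_top_of_projection_mem (hcomm : ∀ x y : A, x * y = y * x) {M : Submodule ℂ A}
    (hM : IsClosed (M : Set A)) (h : ∀ p : A, star p = p → p * p = p → p ∈ M) : M = ⊤ := by
  rw [eq_top_iff, ← CStarAlgebra.span_nonneg, Submodule.span_le]
  intro c hc
  have hc0 : 0 ≤ c := hc
  have key : ∀ n : ℕ, ∃ s ∈ M, 0 ≤ c - s ∧ c - s ≤ algebraMap ℝ A (‖c‖ / 2 ^ n) := by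
    intro n
    induction n with
    | zero =>
      refine ⟨0, zero_mem M, by rwa [sub_zero], ?_⟩
      rw [sub_zero, pow_zero, div_one]
      exact IsSelfAdjoint.le_algebraMap_norm_self (IsSelfAdjoint.of_nonneg hc0)
    | succ n ih =>
      obtain ⟨s, hs, h0, h1⟩ := ih
      have e : ‖c‖ / 2 ^ n = 2 * (‖c‖ / 2 ^ (n + 1)) := by rw [pow_succ]; field_simp
      rw [e] at h1
      obtain ⟨p, hps, hpp, h2, h3⟩ := exists_projection_sub_nonneg_le hcomm h0 h1
      refine ⟨s + algebraMap ℝ A (‖c‖ / 2 ^ (n + 1)) * p, add_mem hs ?_, ?_, ?_⟩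
      · rw [← Algebra.smul_def, ← Complex.coe_smul]
        exact M.smul_mem _ (h p hps hpp)
      · rwa [← sub_sub]
      · rwa [← sub_sub]
  choose s hs h0 h1 using key
  refine hM.mem_of_tendsto (b := Filter.atTop) (f := s) ?_ (Filter.Eventually.of_forall hs)
  rw [tendsto_iff_norm_sub_tendsto_zero]
  have hlim : Filter.Tendsto (fun n : ℕ => ‖c‖ / 2 ^ n) Filter.atTop (nhds 0) :=
    tendsto_const_nhds.div_atTop (tendsto_pow_atTop_atTop_of_one_lt one_lt_two)
  refine squeeze_zero (fun _ => norm_nonneg _) (fun n => ?_) hlim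
  rw [norm_sub_rev]
  exact (CStarAlgebra.norm_le_iff_le_algebraMap _ (by positivity) (h0 n)).mpr (h1 n)

end Projections

/-! ### The normaliser and the normalising groupoid -/

section Normaliser

variable {H : Type*} [NormedAddCommGroup H] [InnerProductSpace ℂ H] [CompleteSpace H]
variable {N A : VonNeumannAlgebra H}

theorem mem_normaliser_iff {u : H →L[ℂ] H} : u ∈ normaliser N A ↔ u ∈ N ∧ star u * u = 1 ∧
    u * star u = 1 ∧ (∀ a ∈ A, u * a * star u ∈ A) ∧ ∀ a ∈ A, star u * a * u ∈ A := by
  constructor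
  · rintro ⟨hN, hu, h⟩
    obtain ⟨h1, h2⟩ := Unitary.mem_iff.mp hu
    refine ⟨hN, h1, h2, fun a ha => h.subset ⟨a, ha, rfl⟩, fun a ha => ?_⟩
    obtain ⟨b, hb, rfl⟩ := h.superset ha
    have : star u * (u * b * star u) * u = b := by
      rw [← mul_assoc, ← mul_assoc, h1, one_mul, mul_assoc, h1, mul_one]
    exact this.symm ▸ hb
  · rintro ⟨hN, h1, h2, h3, h4⟩
    refine ⟨hN, Unitary.mem_iff.mpr ⟨h1, h2⟩, Set.Subset.antisymm ?_ fun a ha => ?_⟩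
    · rintro _ ⟨a, ha, rfl⟩
      exact h3 a ha
    · refine ⟨star u * a * u, h4 a ha, ?_⟩
      simp only
      rw [← mul_assoc, ← mul_assoc, h2, one_mul, mul_assoc, h2, mul_one]

theorem one_mem_normaliser : (1 : H →L[ℂ] H) ∈ normaliser N A := by
  refine mem_normaliser_iff.mpr ⟨one_mem N, by simp, by simp, fun a ha => ?_, fun a ha => ?_⟩ <;>
    simpa using ha

theorem mul_mem_normaliser {u w : H →L[ℂ] H} (hu : u ∈ normaliser N A) (hw : w ∈ normaliser N A) :
    u * w ∈ normaliser N A := by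
  obtain ⟨u0, u1, u2, u3, u4⟩ := mem_normaliser_iff.mp hu
  obtain ⟨w0, w1, w2, w3, w4⟩ := mem_normaliser_iff.mp hw
  refine mem_normaliser_iff.mpr ⟨mul_mem u0 w0, ?_, ?_, fun a ha => ?_, fun a ha => ?_⟩
  · rw [star_mul, mul_assoc, ← mul_assoc (star u), u1, one_mul, w1]
  · rw [star_mul, mul_assoc, ← mul_assoc w, w2, one_mul, u2]
  · simpa only [star_mul, mul_assoc] using u3 _ (w3 a ha)
  · simpa only [star_mul, mul_assoc] using w4 _ (u4 a ha)

theorem star_mem_normaliser {u : H →L[ℂ] H} (hu : u ∈ normaliser N A) :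
    star u ∈ normaliser N A := by
  obtain ⟨u0, u1, u2, u3, u4⟩ := mem_normaliser_iff.mp hu
  exact mem_normaliser_iff.mpr ⟨star_mem u0, by rwa [star_star], by rwa [star_star],
    fun a ha => by simpa only [star_star] using u4 a ha,
    fun a ha => by simpa only [star_star] using u3 a ha⟩

theorem unitary_mem_normaliser (hA : IsMasa N A) {u : H →L[ℂ] H} (hu : u ∈ A)
    (h : u ∈ unitary (H →L[ℂ] H)) : u ∈ normaliser N A := by
  obtain ⟨h1, h2⟩ := Unitary.mem_iff.mp h
  exact mem_normaliser_iff.mpr ⟨hA.mem hu, h1, h2,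
    fun a ha => mul_mem (mul_mem hu ha) (star_mem hu),
    fun a ha => mul_mem (mul_mem (star_mem hu) ha) hu⟩

theorem normaliser_subset_fundamentalSet : normaliser N A ⊆ fundamentalSet N A := by
  intro u hu
  obtain ⟨u0, u1, u2, u3, u4⟩ := mem_normaliser_iff.mp hu
  refine ⟨u0, Set.Subset.antisymm ?_ ?_⟩
  · rintro _ ⟨a, ha, rfl⟩
    refine ⟨star u * a * u, u4 a ha, ?_⟩
    simp only
    rw [← mul_assoc, ← mul_assoc, u2, one_mul]
  · rintro _ ⟨a, ha, rfl⟩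
    refine ⟨u * a * star u, u3 a ha, ?_⟩
    simp only
    rw [mul_assoc, u1, mul_one]

/-- A partial isometry `w` in the groupoid with orthogonal initial and final projections extends to
the self-adjoint unitary `w + w⋆ + (1 - w⋆ w - w w⋆)` in the normaliser. -/
theorem add_star_add_mem_normaliser (hA : IsMasa N A) {w : H →L[ℂ] H} (hw : w ∈ N) (h0 : w * w = 0)
    (h1 : w * star w * w = w) (hA1 : star w * w ∈ A) (hA2 : w * star w ∈ A)
    (hA3 : ∀ a ∈ A, w * a * star w ∈ A) (hA4 : ∀ a ∈ A, star w * a * w ∈ A) :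
    w + star w + (1 - star w * w - w * star w) ∈ normaliser N A := by
  set e := 1 - star w * w - w * star w with he
  have h0' : star w * star w = 0 := by rw [← star_mul, h0, star_zero]
  have h1' : star w * w * star w = star w := by
    rw [mul_assoc, ← star_inj, star_mul, star_mul, star_star, h1]
  have hew : e * w = 0 := by
    rw [he, sub_mul, sub_mul, one_mul, h1, mul_assoc, h0, mul_zero, sub_zero, sub_self]
  have hwe : w * e = 0 := by
    rw [he, mul_sub, mul_sub, mul_one, ← mul_assoc, h1, ← mul_assoc, h0, zero_mul, sub_zero,
      sub_self]
  have hes : star e = e := by simp [he]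
  have hew' : e * star w = 0 := by rw [← hes, ← star_mul, hwe, star_zero]
  have hwe' : star w * e = 0 := by rw [← hes, ← star_mul, hew, star_zero]
  have hee : e * e = e := by
    conv_lhs => rw [he]
    rw [sub_mul, sub_mul, one_mul, mul_assoc, hwe, mul_assoc, hwe', mul_zero, mul_zero, sub_zero,
      sub_zero]
  have heA : e ∈ A := sub_mem (sub_mem (one_mem A) hA1) hA2
  have heN : e ∈ N := sub_mem (sub_mem (one_mem N) (mul_mem (star_mem hw) hw))
    (mul_mem hw (star_mem hw))
  set u := w + star w + e with hu
  have hus : star u = u := by simp only [hu, star_add, star_star, hes]; abel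
  have huu : u * u = 1 := by
    simp only [hu, mul_add, add_mul, h0, h0', hew, hwe, hew', hwe', hee]
    rw [he]
    abel
  have haux : ∀ X Y r : H →L[ℂ] H, r ∈ A → X * r = X → r * Y = 0 → ∀ a ∈ A, X * a * Y = 0 := by
    intro X Y r hr hX hY a ha
    rw [← hX, mul_assoc X, ← hA.comm ha hr, ← mul_assoc X, mul_assoc, hY, mul_zero]
  have hwr : w * (star w * w) = w := by rw [← mul_assoc, h1]
  have hws : star w * (w * star w) = star w := by rw [← mul_assoc, h1']
  have hu3 : ∀ a ∈ A, u * a * u ∈ A := by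
    intro a ha
    have k1 := haux w w _ hA1 hwr (by rw [mul_assoc, h0, mul_zero]) a ha
    have k2 := haux w e _ hA1 hwr (by rw [mul_assoc, hwe, mul_zero]) a ha
    have k3 := haux (star w) (star w) _ hA2 hws (by rw [mul_assoc, h0', mul_zero]) a ha
    have k4 := haux (star w) e _ hA2 hws (by rw [mul_assoc, hwe', mul_zero]) a ha
    have k5 := haux e w e heA hee hew a ha
    have k6 := haux e (star w) e heA hee hew' a ha
    have : u * a * u = w * a * star w + star w * a * w + e * a * e := by
      simp only [hu, mul_add, add_mul, k1, k2, k3, k4, k5, k6]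
      abel
    rw [this]
    exact add_mem (add_mem (hA3 a ha) (hA4 a ha)) (mul_mem (mul_mem heA ha) heA)
  exact mem_normaliser_iff.mpr ⟨add_mem (add_mem hw (star_mem hw)) heN, by rw [hus, huu],
    by rw [hus, huu], by rwa [hus], by rwa [hus]⟩

end Normaliser

/-! ### The closed span of the normaliser -/

section NormaliserSpan

variable {H : Type*} [NormedAddCommGroup H] [InnerProductSpace ℂ H] [CompleteSpace H]
variable {N A : VonNeumannAlgebra H} {τ : N →ₚ[ℂ] ℂ}

/-- The inclusion of a masa `A` in `N`, as a linear map. -/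
noncomputable def IsMasa.inclusion (hA : IsMasa N A) : A →ₗ[ℂ] N where
  toFun a := ⟨a, hA.mem a.2⟩
  map_add' _ _ := rfl
  map_smul' _ _ := rfl

/-- `a ↦ a ζ` as a linear map. -/
noncomputable def leftOrbitₗ (ζ : L2 τ) : N →ₗ[ℂ] L2 τ where
  toFun a := leftMul τ a ζ
  map_add' a b := by rw [leftMul_add]; rfl
  map_smul' c a := by rw [leftMul_smul]; rfl

theorem continuous_leftMul_apply (ζ : L2 τ) : Continuous fun a : N => leftMul τ a ζ :=
  AddMonoidHomClass.continuous_of_bound (leftOrbitₗ ζ) ‖ζ‖ fun a => by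
    rw [mul_comm]; exact norm_leftMul_apply_le τ a ζ

variable (hτ : IsFaithfulNormalTracialState τ)

theorem norm_rightMul_apply_le (b : N) (ζ : L2 τ) : ‖rightMul hτ b ζ‖ ≤ ‖b‖ * ‖ζ‖ := by
  refine (denseRange_hat τ).induction_on (p := fun ζ => ‖rightMul hτ b ζ‖ ≤ ‖b‖ * ‖ζ‖) ζ
    (isClosed_le (by fun_prop) (by fun_prop)) fun x => ?_
  have h := norm_leftMul_apply_le τ (star b) (hat τ (star x))
  rwa [leftMul_hat, ← star_mul, norm_hat_star hτ, norm_hat_star hτ, norm_star,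
    ← rightMul_hat hτ] at h

/-- `a ↦ ζ a` as a linear map. -/
noncomputable def rightOrbitₗ (ζ : L2 τ) : N →ₗ[ℂ] L2 τ where
  toFun a := rightMul hτ a ζ
  map_add' a b := by rw [rightMul_add]; rfl
  map_smul' c a := by rw [rightMul_smul]; rfl

theorem continuous_rightMul_apply (ζ : L2 τ) : Continuous fun a : N => rightMul hτ a ζ :=
  AddMonoidHomClass.continuous_of_bound (rightOrbitₗ hτ ζ) ‖ζ‖ fun a => by
    rw [mul_comm]; exact norm_rightMul_apply_le hτ a ζ

variable (hA : IsMasa N A)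
include hA

/-- A vector that commutes with the projections of a masa commutes with the masa. -/
theorem leftMul_eq_rightMul_of_projection {ζ : L2 τ}
    (h : ∀ p : N, (p : H →L[ℂ] H) ∈ A → star p = p → p * p = p →
      leftMul τ p ζ = rightMul hτ p ζ) {a : N} (ha : (a : H →L[ℂ] H) ∈ A) :
    leftMul τ a ζ = rightMul hτ a ζ := by
  have hi : Continuous hA.inclusion := Continuous.subtype_mk continuous_subtype_val _
  let M : Submodule ℂ A :=
    LinearMap.eqLocus (leftOrbitₗ ζ ∘ₗ hA.inclusion) (rightOrbitₗ hτ ζ ∘ₗ hA.inclusion)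
  have hM : IsClosed (M : Set A) := isClosed_eq ((continuous_leftMul_apply ζ).comp hi)
    ((continuous_rightMul_apply hτ ζ).comp hi)
  have htop : M = ⊤ := eq_top_of_projection_mem (fun x y => Subtype.ext (hA.comm x.2 y.2)) hM
    fun p hps hpp => h (hA.inclusion p) p.2 (Subtype.ext (congrArg (fun x : A => (x : H →L[ℂ] H)) hps))
      (Subtype.ext (congrArg (fun x : A => (x : H →L[ℂ] H)) hpp))
  have : (⟨a, ha⟩ : A) ∈ M := htop ▸ Submodule.mem_top
  exact this

/-- Since `A` is spanned by its unitaries, which lie in `N(A)`, a linear property of elements of `A`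
has to be checked only on `A ∩ N(A)`. -/
theorem span_unitary_induction {p : N → Prop} (h0 : p 0) (hadd : ∀ x y, p x → p y → p (x + y))
    (hsmul : ∀ (c : ℂ) x, p x → p (c • x))
    (hu : ∀ u : N, (u : H →L[ℂ] H) ∈ A → (u : H →L[ℂ] H) ∈ normaliser N A → p u)
    {a : N} (ha : (a : H →L[ℂ] H) ∈ A) : p a := by
  have hmem : (⟨a, ha⟩ : A) ∈ Submodule.span ℂ (unitary A : Set A) := by
    rw [CStarAlgebra.span_unitary]; exact Submodule.mem_top
  have key : ∀ x ∈ Submodule.span ℂ (unitary A : Set A), p (hA.inclusion x) := by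
    intro x hx
    induction hx using Submodule.span_induction with
    | mem x hx =>
      refine hu _ x.2 (unitary_mem_normaliser hA x.2 (Unitary.mem_iff.mpr ?_))
      obtain ⟨h1, h2⟩ := Unitary.mem_iff.mp hx
      exact ⟨congrArg Subtype.val h1, congrArg Subtype.val h2⟩
    | zero => rw [map_zero]; exact h0
    | add x y _ _ hx hy => rw [map_add]; exact hadd _ _ hx hy
    | smul c x _ hx => rw [map_smul]; exact hsmul c _ hx
  exact key _ hmem

theorem leftMul_mem_L2Of_normaliser {a : N} (ha : (a : H →L[ℂ] H) ∈ A) {ζ : L2 τ}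
    (hζ : ζ ∈ L2Of τ (normaliser N A)) : leftMul τ a ζ ∈ L2Of τ (normaliser N A) := by
  refine span_unitary_induction hA (p := fun a => leftMul τ a ζ ∈ L2Of τ (normaliser N A)) ?_
    (fun x y hx hy => ?_) (fun c x hx => ?_) (fun u _ hu => ?_) ha
  · rw [show leftMul τ (0 : N) ζ = 0 from (leftOrbitₗ ζ).map_zero]; exact zero_mem _
  · rw [leftMul_add]; exact add_mem hx hy
  · rw [leftMul_smul]; exact Submodule.smul_mem _ c hx
  · have h : L2Of τ (normaliser N A) ≤
        (L2Of τ (normaliser N A)).comap (leftMul τ u).toLinearMap := by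
      refine L2Of_le ((isClosed_L2Of _).preimage (leftMul τ u).continuous) fun w hw => ?_
      change leftMul τ u (hat τ w) ∈ L2Of τ (normaliser N A)
      rw [leftMul_hat]
      exact hat_mem_L2Of (mul_mem_normaliser hu hw)
    exact h hζ

theorem rightMul_mem_L2Of_normaliser {a : N} (ha : (a : H →L[ℂ] H) ∈ A) {ζ : L2 τ}
    (hζ : ζ ∈ L2Of τ (normaliser N A)) : rightMul hτ a ζ ∈ L2Of τ (normaliser N A) := by
  refine span_unitary_induction hA (p := fun a => rightMul hτ a ζ ∈ L2Of τ (normaliser N A)) ?_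
    (fun x y hx hy => ?_) (fun c x hx => ?_) (fun u _ hu => ?_) ha
  · rw [show rightMul hτ (0 : N) ζ = 0 from (rightOrbitₗ hτ ζ).map_zero]; exact zero_mem _
  · rw [rightMul_add]; exact add_mem hx hy
  · rw [rightMul_smul]; exact Submodule.smul_mem _ c hx
  · have h : L2Of τ (normaliser N A) ≤
        (L2Of τ (normaliser N A)).comap (rightMul hτ u).toLinearMap := by
      refine L2Of_le ((isClosed_L2Of _).preimage (rightMul hτ u).continuous) fun w hw => ?_
      change rightMul hτ u (hat τ w) ∈ L2Of τ (normaliser N A)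
      rw [rightMul_hat]
      exact hat_mem_L2Of (mul_mem_normaliser hw hu)
    exact h hζ

theorem L2Of_le_L2Of_normaliser :
    L2Of τ (A : Set (H →L[ℂ] H)) ≤ L2Of τ (normaliser N A) := by
  refine L2Of_le (isClosed_L2Of _) fun a ha => ?_
  rw [← leftMul_hat_one]
  exact leftMul_mem_L2Of_normaliser hA ha (hat_mem_L2Of one_mem_normaliser)

include hτ in
/-- If `v ∈ GN(A)` and `p, q` are orthogonal projections of `A`, then `w = q v p` has orthogonal
initial and final projections, so `w = u w⋆ w` for some `u ∈ N(A)`. -/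
theorem hat_mul_mul_mem_L2Of_normaliser {v : N} (hv : v ∈ normalisingGroupoid N A) {p q : N}
    (hpA : (p : H →L[ℂ] H) ∈ A) (hqA : (q : H →L[ℂ] H) ∈ A) (hps : star p = p) (hqs : star q = q)
    (hpp : p * p = p) (hqq : q * q = q) (hpq : p * q = 0) :
    hat τ (q * v * p) ∈ L2Of τ (normaliser N A) := by
  obtain ⟨hv0, hv1, hv2, -⟩ := id hv
  set w := q * v * p with hw
  have hws : star w = p * star v * q := by
    rw [hw, star_mul, star_mul, hps, hqs, mul_assoc]
  have hww : w * w = 0 := by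
    have : w * w = q * v * (p * q) * v * p := by rw [hw]; simp only [mul_assoc]
    rw [this, hpq]; simp
  have hA3 : ∀ a : N, (a : H →L[ℂ] H) ∈ A → ((w * a * star w : N) : H →L[ℂ] H) ∈ A := by
    intro a ha
    have : w * a * star w = q * (v * (p * a * p) * star v) * q := by
      rw [hws, hw]; simp only [mul_assoc]
    rw [this]
    exact mul_mem (mul_mem hqA (conj_mem_of_mem_normalisingGroupoid hv
      (mul_mem (mul_mem hpA ha) hpA))) hqA
  have hA4 : ∀ a : N, (a : H →L[ℂ] H) ∈ A → ((star w * a * w : N) : H →L[ℂ] H) ∈ A := by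
    intro a ha
    have : star w * a * w = p * (star v * (q * a * q) * v) * p := by
      rw [hws, hw]; simp only [mul_assoc]
    rw [this]
    exact mul_mem (mul_mem hpA (star_conj_mem_of_mem_normalisingGroupoid hv
      (mul_mem (mul_mem hqA ha) hqA))) hpA
  have h1A : ((1 : N) : H →L[ℂ] H) ∈ A := one_mem A
  have hA1 : ((star w * w : N) : H →L[ℂ] H) ∈ A := by simpa only [mul_one] using hA4 1 h1A
  have hA2 : ((w * star w : N) : H →L[ℂ] H) ∈ A := by simpa only [mul_one] using hA3 1 h1A
  have hwww : w * star w * w = w := by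
    -- `v p v⋆` commutes with `q` and `p` commutes with `v⋆ v`
    have e1 := hA.comm' (conj_mem_of_mem_normalisingGroupoid hv hpA) hqA
    have e2 := hA.comm' hv1 hpA
    calc w * star w * w = q * (v * (p * p) * star v * (q * q)) * v * p := by
          rw [hws, hw]; simp only [mul_assoc]
      _ = q * (q * (v * p * star v)) * v * p := by rw [hpp, hqq, e1]
      _ = q * q * v * (p * (star v * v)) * p := by simp only [mul_assoc]
      _ = q * (v * star v * v) * (p * p) := by
          rw [hqq, ← e2]; simp only [mul_assoc]
      _ = w := by rw [hv0, hpp]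
  have hmemN := add_star_add_mem_normaliser hA w.2 (congrArg Subtype.val hww)
    (congrArg Subtype.val hwww) hA1 hA2 (fun a ha => hA3 ⟨a, hA.mem ha⟩ ha)
    (fun a ha => hA4 ⟨a, hA.mem ha⟩ ha)
  set u : N := w + star w + (1 - star w * w - w * star w) with hu
  have huw : u * (star w * w) = w := by
    have k1 : w * (star w * w) = w := by rw [← mul_assoc, hwww]
    have k2 : star w * (star w * w) = 0 := by rw [← mul_assoc, ← star_mul, hww, star_zero, zero_mul]
    have k3 : w * star w * (star w * w) = 0 := by rw [mul_assoc, k2, mul_zero]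
    have k4 : star w * w * (star w * w) = star w * w := by rw [mul_assoc, k1]
    rw [hu, add_mul, add_mul, sub_mul, sub_mul, one_mul, k1, k2, k3, k4]
    abel
  rw [← huw, ← rightMul_hat hτ]
  exact rightMul_mem_L2Of_normaliser hτ hA hA1 (hat_mem_L2Of hmemN)

include hτ in
/-- Dye's argument in `L²`: the component `η` of `v` orthogonal to the span of `N(A)` satisfies
`q η p = 0` for orthogonal projections `p, q ∈ A`, so it commutes with `A`; but `L²(A, τ)` lies in
that span, hence `η = 0`. -/
theorem hat_mem_L2Of_normaliser {v : N} (hv : v ∈ normalisingGroupoid N A) :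
    hat τ v ∈ L2Of τ (normaliser N A) := by
  set W := L2Of τ (normaliser N A) with hW
  have hpW : W.starProjection (hat τ v) ∈ W := W.starProjection_apply_mem _
  have horth : ∀ w ∈ W, ⟪w, hat τ v - W.starProjection (hat τ v)⟫_ℂ = 0 := fun w hw => by
    rw [← inner_conj_symm, W.starProjection_inner_eq_zero _ w hw, map_zero]
  set η := hat τ v - W.starProjection (hat τ v) with hη
  have hzero : ∀ p q : N, (p : H →L[ℂ] H) ∈ A → (q : H →L[ℂ] H) ∈ A → star p = p → star q = q →
      p * p = p → q * q = q → p * q = 0 → leftMul τ q (rightMul hτ p η) = 0 := by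
    intro p q hpA hqA hps hqs hpp hqq hpq
    have h1 : leftMul τ q (rightMul hτ p η) ∈ W := by
      rw [hη, map_sub, map_sub, rightMul_hat, leftMul_hat, ← mul_assoc]
      exact sub_mem (hat_mul_mul_mem_L2Of_normaliser hτ hA hv hpA hqA hps hqs hpp hqq hpq)
        (leftMul_mem_L2Of_normaliser hA hqA (rightMul_mem_L2Of_normaliser hτ hA hpA hpW))
    rw [← inner_self_eq_zero (𝕜 := ℂ), inner_leftMul, inner_rightMul, hps, hqs]
    exact horth _ (rightMul_mem_L2Of_normaliser hτ hA hpA (leftMul_mem_L2Of_normaliser hA hqA h1))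
  have hηA : η ∈ L2Of τ (A : Set (H →L[ℂ] H)) := by
    refine (mem_L2Of_iff_commute hτ hA).mpr fun a ha =>
      leftMul_eq_rightMul_of_projection hτ hA (fun p hpA hps hpp => ?_) ha
    have h1A : ((1 - p : N) : H →L[ℂ] H) ∈ A := sub_mem (one_mem A) hpA
    have hs : star (1 - p) = 1 - p := by rw [star_sub, star_one, hps]
    have k1 : p * (1 - p) = 0 := by rw [mul_sub, mul_one, hpp, sub_self]
    have k2 : (1 - p) * p = 0 := by rw [sub_mul, one_mul, hpp, sub_self]
    have k3 : (1 - p) * (1 - p) = 1 - p := by rw [mul_sub, mul_one, k2, sub_zero]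
    have e1 := hzero p (1 - p) hpA h1A hps hs hpp k3 k1
    have e2 := hzero (1 - p) p h1A hpA hs hps k3 hpp k2
    rw [leftMul_sub, sub_apply, leftMul_one_apply, sub_eq_zero] at e1
    rw [rightMul_sub, sub_apply, rightMul_one_apply, map_sub, sub_eq_zero] at e2
    rw [e1, e2]
  have hη0 : η = 0 := by
    rw [← inner_self_eq_zero (𝕜 := ℂ)]
    exact horth η (L2Of_le_L2Of_normaliser hA hηA)
  rw [sub_eq_zero.mp (hη.symm.trans hη0)]
  exact hpW

include hτ in
/-- An element of `Nᶠ(A)` is `v ξ` with `v ∈ GN(A)` and `ξ ∈ L²(A, τ)`, a `‖·‖₂`-limit of elements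
`v a` with `a ∈ A`. -/
theorem L2Of_fundamentalSet_le : L2Of τ (fundamentalSet N A) ≤ L2Of τ (normaliser N A) := by
  refine L2Of_le (isClosed_L2Of _) fun x hx => ?_
  have hmem : hat τ x ∈ weakFundamentalSet hτ A := by
    refine Set.Subset.antisymm ?_ ?_
    · rintro _ ⟨a, ha, rfl⟩
      obtain ⟨b, hb, hab⟩ := hx.2.subset ⟨a, ha, rfl⟩
      refine ⟨⟨b, hA.mem hb⟩, hb, ?_⟩
      simp only
      rw [rightMul_hat, leftMul_hat]
      exact congrArg (hat τ) (Subtype.ext hab)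
    · rintro _ ⟨a, ha, rfl⟩
      obtain ⟨b, hb, hab⟩ := hx.2.superset ⟨a, ha, rfl⟩
      refine ⟨⟨b, hA.mem hb⟩, hb, ?_⟩
      simp only
      rw [rightMul_hat, leftMul_hat]
      exact congrArg (hat τ) (Subtype.ext hab)
  obtain ⟨ξ, hξ, v, hv, hxv⟩ := exists_eq_leftMul_of_mem_weakFundamentalSet hτ hA hmem
  rw [hxv]
  have h : L2Of τ (A : Set (H →L[ℂ] H)) ≤
      (L2Of τ (normaliser N A)).comap (leftMul τ v).toLinearMap := by
    refine L2Of_le ((isClosed_L2Of _).preimage (leftMul τ v).continuous) fun a ha => ?_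
    change leftMul τ v (hat τ a) ∈ L2Of τ (normaliser N A)
    rw [leftMul_hat, ← rightMul_hat hτ]
    exact rightMul_mem_L2Of_normaliser hτ hA ha (hat_mem_L2Of_normaliser hτ hA hv)
  exact h hξ

include hτ in
theorem L2Of_fundamentalSet_eq : L2Of τ (fundamentalSet N A) =
    L2Of τ (Set.centralizer (Set.centralizer (normaliser N A))) := by
  have hmono : ∀ {S T : Set (H →L[ℂ] H)}, S ⊆ T → L2Of τ S ≤ L2Of τ T := fun h =>
    L2Of_le (isClosed_L2Of _) fun _ hx => hat_mem_L2Of (h hx)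
  refine le_antisymm ((L2Of_fundamentalSet_le hτ hA).trans (hmono ?_)) ?_
  · exact Set.subset_centralizer_centralizer
  · refine (L2Of_centralizer_centralizer_le hτ (fun u hu => hu.1) one_mem_normaliser
      (fun x hx y hy => mul_mem_normaliser hx hy) fun x hx => star_mem_normaliser hx).trans
      (hmono normaliser_subset_fundamentalSet)

end NormaliserSpan

end VonNeumannAlgebra

/-- Here `L2Of τ A` is `L²(A, τ)`, the double centralizer of `normaliser N A` is the von Neumann
algebra `N(A)''`, and `L2Of τ (fundamentalSet N A)` is the closed span of the fundamental set. -/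
theorem mainTheorem3 {H : Type*} [NormedAddCommGroup H] [InnerProductSpace ℂ H] [CompleteSpace H]
    (N A : VonNeumannAlgebra H) (τ : N →ₚ[ℂ] ℂ)
    (hτ : VonNeumannAlgebra.IsFaithfulNormalTracialState τ)
    (hA : VonNeumannAlgebra.IsMasa N A) :
    (∀ ζ : VonNeumannAlgebra.L2 τ, ζ ∈ VonNeumannAlgebra.weakFundamentalSet hτ A ↔
      ∃ ξ ∈ VonNeumannAlgebra.L2Of τ (A : Set (H →L[ℂ] H)),
        ∃ v ∈ VonNeumannAlgebra.normalisingGroupoid N A, ζ = VonNeumannAlgebra.leftMul τ v ξ) ∧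
    VonNeumannAlgebra.L2Of τ (VonNeumannAlgebra.fundamentalSet N A) =
      VonNeumannAlgebra.L2Of τ
        (Set.centralizer (Set.centralizer (VonNeumannAlgebra.normaliser N A))) := by
  exact ⟨VonNeumannAlgebra.mem_weakFundamentalSet_iff hτ hA,
    VonNeumannAlgebra.L2Of_fundamentalSet_eq hτ hA⟩
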